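/- **Setting.** Let $M\ge 1$ and $N\ge 2$. Let $\mathcal G$ be a fixed, undirected, connected graph on $\{1,\dots,N\}$ without self-edges, with symmetric weighted adjacency matrix $A=[a_{ij}]$ ($a_{ij}>0$ if $\{i,j\}$ is an edge, $a_{ij}=0$ otherwise), and let $\mathcal N_i$ be the set of neighbours of $i$. Let $L$ be its Laplacian ($l_{ij}=-a_{ij}$ for $i\ne j$, $l_{ii}=\sum_j a_{ij}$), and let $\lambda_{\min}(\Lambda)$ be the smallest positive eigenvalue of $L$. The state $x_T=(x_T^{(0)},\dots,x_T^{(M-1)})\in\mathbb R^{3M}$ of a target with position $p_T=x_T^{(0)}\in\mathbb R^3$ obeys, on $[t_0,\infty)$, $$\dot x_T^{(m)}=x_T^{(m+1)}\ (0\le m<M-1),\qquad \dot x_T^{(M-1)}=u .$$ The target is autonomous if $u=0$; a piecewise continuous input $u:[t_0,\infty)\to\mathbb R^3$ is also considered, in which case $x_T$ is continuous and the last equation holds wherever $u$ is continuous. Agent $i$ has position $p_i(t)\in\mathbb R^3$ with $p_i(t)\neq p_T(t)$ for $t\ge t_0$ and measures the bearing $b_i=(p_T-p_i)/\|p_T-p_i\|$.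 Put $\Pi_{b_i}=I_3-b_ib_i^\top$, assumed continuous in $t\ge t_0$, and $y_i=\Pi_{b_i}p_i$, which equals $\Pi_{b_i}p_T$. With positive gains $k_1,\dots,k_M$ and $\alpha>0$, the observer of agent $i$ is $$\dot{\hat x}_i^{(m)}=\hat x_i^{(m+1)}+k_{m+1}\delta_i\ (m<M-1),\qquad \dot{\hat x}_i^{(M-1)}=k_M\delta_i,$$ $$\delta_i=\Pi_{b_i}\big(p_i-\hat x_i^{(0)}\big)-\alpha\sum_{j\in\mathcal N_i}a_{ij}\big(\hat x_i^{(0)}-\hat x_j^{(0)}\big),$$ and the estimation error $\tilde x\in\mathbb R^{3NM}$ has components $\tilde x_i^{(m)}=x_T^{(m)}-\hat x_i^{(m)}$. **Conditions.** Let $\delta,\gamma>0$, and let $\mu=\delta$ if $M=1$ and $\mu=(\delta k_1+k_2)/k_1^2$ if $M\ge2$. Assume: 1. $\frac1N\sum_{i=1}^N\Pi_{b_i(t)}\succ(\mu+\gamma)I_3$ for all $t\ge t_0$; 2. $\displaystyle \alpha>\frac{\mu+\frac1\gamma-1}{\lambda_{\min}(\Lambda)}$; 3. if $M\ge 3$,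 then $\bar\Sigma+\bar\Sigma^\top\succ0$, where, with $c_l=k_{l+1}/k_l$, the matrix $\bar\Sigma\in\mathbb R^{M\times M}$ has the entries $\bar\Sigma_{1j}=c_{M-1}$ for all $j$; $\bar\Sigma_{ij}=c_{M-i}-c_{M-i+1}$ for $2\le i\le j$ and $i<M$; $\bar\Sigma_{ij}=-c_{M-j}$ for $i=j+1$; $\bar\Sigma_{MM}=\delta$; and $\bar\Sigma_{ij}=0$ for $i>j+1$. **Claim.** (a) If $u=0$, the origin of the estimation error system is uniformly globally exponentially stable (UGES): there are constants $C,r>0$, depending only on the graph, its weights, $M$, the gains, $\delta$ and $\gamma$ (not on $t_0$, the agents' positions, or the target trajectory), such that for every initial time $s\ge t_0$ and every initial error the error system has a solution on $[s,\infty)$, and every solution satisfies $\|\tilde x(t)\|\le C e^{-r(t-s)}\|\tilde x(s)\|$ for all $t\ge s$. (b) The estimation error is input-to-state stable (ISS) with respect to $u$: there are a class $\mathcal{KL}$ function $\beta$ and a class $\mathcal K$ function $\rho$, depending only on the same data, such that for every bounded, piecewise continuous input $u$, every initial time $s\ge t_0$ and every initial error there is a solution on $[s,\infty)$, and every solution satisfies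 $$\|\tilde x(t)\|\le\beta(\|\tilde x(s)\|,t-s)+\rho\Big(\sup_{s\le\tau\le t}\|u(\tau)\|\Big)\quad\text{for all }t\ge s.$$ -/

import Mathlib

open scoped Topology

namespace BearingObserver

/-! ### Comparison functions and input signals -/

/-- Class `𝒦` functions on `[0, ∞)`. -/
structure IsClassK (ρ : ℝ → ℝ) : Prop where
  continuousOn : ContinuousOn ρ (Set.Ici 0)
  strictMonoOn : StrictMonoOn ρ (Set.Ici 0)
  map_zero : ρ 0 = 0

/-- Class `𝒦ℒ` functions on `[0, ∞) × [0, ∞)`. -/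
structure IsClassKL (β : ℝ → ℝ → ℝ) : Prop where
  continuousOn : ContinuousOn (fun q : ℝ × ℝ => β q.1 q.2) (Set.Ici 0 ×ˢ Set.Ici 0)
  classK : ∀ s, 0 ≤ s → IsClassK (fun r => β r s)
  antitoneOn : ∀ r, 0 ≤ r → AntitoneOn (β r) (Set.Ici 0)
  tendsto_zero : ∀ r, 0 ≤ r → Filter.Tendsto (β r) Filter.atTop (𝓝 0)

/-- Piecewise continuity on `[t₀, ∞)`: the discontinuities are finitely many in every bounded
interval, and all one-sided limits exist. -/
def PiecewiseContinuousFrom {E : Type*} [TopologicalSpace E] (t₀ : ℝ) (u : ℝ → E) : Prop :=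
  (∀ T : ℝ, {t ∈ Set.Icc t₀ T | ¬ ContinuousWithinAt u (Set.Ici t₀) t}.Finite) ∧
  (∀ t, t₀ ≤ t → ∃ l, Filter.Tendsto u (𝓝[>] t) (𝓝 l)) ∧
  (∀ t, t₀ < t → ∃ l, Filter.Tendsto u (𝓝[<] t) (𝓝 l))

/-- Boundedness on `[t₀, ∞)`. -/
def BoundedFrom {E : Type*} [Norm E] (t₀ : ℝ) (u : ℝ → E) : Prop :=
  ∃ B : ℝ, ∀ t, t₀ ≤ t → ‖u t‖ ≤ B

/-! ### Stability

A system on `[t₀, ∞)` is represented by its solutions: `Sol s ξ` says that `ξ` is a solution on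
`[s, ∞)` with initial time `s`. -/

/-- Every initial condition `ξ₀` at every initial time `s ≥ t₀` has a solution on `[s, ∞)`. -/
def ForwardComplete {E : Type*} (t₀ : ℝ) (Sol : ℝ → (ℝ → E) → Prop) : Prop :=
  ∀ s, t₀ ≤ s → ∀ ξ₀ : E, ∃ ξ : ℝ → E, Sol s ξ ∧ ξ s = ξ₀

/-- Uniform global exponential stability of the origin, with overshoot `C` and rate `r`. -/
def UGESWith {E : Type*} [Norm E] (C r t₀ : ℝ) (Sol : ℝ → (ℝ → E) → Prop) : Prop :=
  ForwardComplete t₀ Sol ∧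
  ∀ s, t₀ ≤ s → ∀ ξ, Sol s ξ → ∀ t, s ≤ t → ‖ξ t‖ ≤ C * Real.exp (-r * (t - s)) * ‖ξ s‖

/-- The input-to-state estimate with comparison functions `β`, `ρ` under the input `u`. -/
def ISSWith {E F : Type*} [Norm E] [Norm F] (β : ℝ → ℝ → ℝ) (ρ : ℝ → ℝ) (t₀ : ℝ) (u : ℝ → F)
    (Sol : ℝ → (ℝ → E) → Prop) : Prop :=
  ForwardComplete t₀ Sol ∧
  ∀ s, t₀ ≤ s → ∀ ξ, Sol s ξ → ∀ t, s ≤ t →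
    ‖ξ t‖ ≤ β ‖ξ s‖ (t - s) + ρ (sSup ((fun τ => ‖u τ‖) '' Set.Icc s t))

/-! ### Communication graph -/

/-- `A` is a weighted adjacency matrix of the undirected graph `G`. -/
structure IsWeightedAdjacency {N : ℕ} (G : SimpleGraph (Fin N)) (A : Matrix (Fin N) (Fin N) ℝ) :
    Prop where
  symm : A.IsSymm
  pos : ∀ i j, G.Adj i j → 0 < A i j
  zero : ∀ i j, ¬ G.Adj i j → A i j = 0

/-- The Laplacian: `lᵢⱼ = -aᵢⱼ` for `i ≠ j` and `lᵢᵢ = ∑ⱼ aᵢⱼ` (`aᵢⱼ = 0` off the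
neighbours of `i`, in particular `aᵢᵢ = 0`). -/
def laplacian {N : ℕ} (A : Matrix (Fin N) (Fin N) ℝ) : Matrix (Fin N) (Fin N) ℝ :=
  Matrix.of fun i j => if i = j then ∑ l, A i l else - A i j

/-- The smallest positive eigenvalue of a matrix (for the Laplacian of a connected graph on at
least two vertices the set is finite and nonempty). -/
noncomputable def minPosEigenvalue {N : ℕ} (L : Matrix (Fin N) (Fin N) ℝ) : ℝ :=
  sInf {l : ℝ | 0 < l ∧ Module.End.HasEigenvalue (Matrix.toLin' L) l}

/-! ### Bearings -/

/-- Physical space `ℝ³` with the Euclidean norm. -/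
abbrev Space := EuclideanSpace ℝ (Fin 3)

/-- The unit bearing from an agent at `p` to a target at `q` (used for `q ≠ p`). -/
noncomputable def bearing (p q : Space) : Space := ‖q - p‖⁻¹ • (q - p)

/-- `Π_b = I₃ - b bᵀ`. -/
def proj (b : Space) : Matrix (Fin 3) (Fin 3) ℝ := 1 - Matrix.vecMulVec b b

/-- Matrix-vector product on `ℝ³`. -/
noncomputable def act (Q : Matrix (Fin 3) (Fin 3) ℝ) (v : Space) : Space :=
  WithLp.toLp 2 (Q.mulVec v.ofLp)

/-- On `[t₀, ∞)` all bearings from the agents `p i` to the target at `q` are defined, and the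
measurement matrices depend continuously on time (they are automatically bounded). -/
structure IsBearingSensing {N : ℕ} (t₀ : ℝ) (p : Fin N → ℝ → Space) (q : ℝ → Space) : Prop where
  ne : ∀ t, t₀ ≤ t → ∀ i, q t ≠ p i t
  continuousOn : ∀ i, ContinuousOn (fun t => proj (bearing (p i t) (q t))) (Set.Ici t₀)

/-- Spatial excitation: `(1/N) ∑ᵢ Π_{bᵢ(t)} ≻ c I₃` for all `t ≥ t₀`. -/
def SpatialExcitation {N : ℕ} (c t₀ : ℝ) (p : Fin N → ℝ → Space) (q : ℝ → Space) : Prop :=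
  ∀ t, t₀ ≤ t →
    ((1 / (N : ℝ)) • ∑ i, proj (bearing (p i t) (q t)) -
      c • (1 : Matrix (Fin 3) (Fin 3) ℝ)).PosDef

/-! ### Target and observer. Gains are indexed as `k 1, …, k M`. -/

/-- `x` is a state trajectory on `[t₀, ∞)` of the chain of `M` integrators with input `u` at the
last derivative. For a piecewise continuous `u` the last equation is required where `u` is
continuous; for `u = 0` it is required everywhere. -/
structure IsTargetTrajectory {M : ℕ} (t₀ : ℝ) (u : ℝ → Space) (x : ℝ → Fin M → Space) :
    Prop where
  continuousOn : ContinuousOn x (Set.Ici t₀)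
  deriv_chain : ∀ t, t₀ ≤ t → ∀ m m' : Fin M, (m' : ℕ) = (m : ℕ) + 1 →
    HasDerivWithinAt (fun τ => x τ m) (x t m') (Set.Ici t₀) t
  deriv_last : ∀ t, t₀ ≤ t → ContinuousWithinAt u (Set.Ici t₀) t →
    ∀ m : Fin M, (m : ℕ) + 1 = M → HasDerivWithinAt (fun τ => x τ m) (u t) (Set.Ici t₀) t

/-- The correction term `δᵢ` of agent `i`, from the agents' positions `p`, the target position
`q` (which enters only through the bearing of agent `i`) and the position estimates `phat`. -/
noncomputable def correction {N : ℕ} (A : Matrix (Fin N) (Fin N) ℝ) (α : ℝ) (p : Fin N → Space)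
    (q : Space) (phat : Fin N → Space) (i : Fin N) : Space :=
  act (proj (bearing (p i) q)) (p i - phat i) - α • ∑ j, A i j • (phat i - phat j)

/-- `z` is a solution on `[s, ∞)` of the distributed observer; `z t i m` is the estimate by
agent `i` of the `m`-th component of the target state. -/
def IsObserverSolution {M N : ℕ} [NeZero M] (A : Matrix (Fin N) (Fin N) ℝ) (α : ℝ) (k : ℕ → ℝ)
    (p : Fin N → ℝ → Space) (q : ℝ → Space) (s : ℝ) (z : ℝ → Fin N → Fin M → Space) : Prop :=
  ∀ t, s ≤ t → ∀ (i : Fin N) (m : Fin M),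
    HasDerivWithinAt (fun τ => z τ i m)
      ((if h : (m : ℕ) + 1 < M then z t i ⟨(m : ℕ) + 1, h⟩ else 0) +
        k ((m : ℕ) + 1) • correction A α (fun j => p j t) (q t) (fun j => z t j 0) i)
      (Set.Ici s) t

/-- The space `ℝ^{3NM}` of estimation errors, with the Euclidean norm. -/
abbrev ErrorSpace (M N : ℕ) := PiLp 2 (fun _ : Fin M × Fin N => Space)

/-- The estimation error, with components `x^{(m)} - xhat_i^{(m)}`. -/
noncomputable def estimationError {M N : ℕ} (x : Fin M → Space) (z : Fin N → Fin M → Space) :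
    ErrorSpace M N :=
  WithLp.toLp 2 fun mi => x mi.1 - z mi.2 mi.1

/-- The solutions of the estimation error system along the target trajectory `x`. -/
def ErrorSolution {M N : ℕ} [NeZero M] (A : Matrix (Fin N) (Fin N) ℝ) (α : ℝ) (k : ℕ → ℝ)
    (p : Fin N → ℝ → Space) (x : ℝ → Fin M → Space) (s : ℝ) (e : ℝ → ErrorSpace M N) : Prop :=
  ∃ z : ℝ → Fin N → Fin M → Space,
    IsObserverSolution A α k p (fun t => x t 0) s z ∧
    ∀ t, s ≤ t → e t = estimationError (x t) (z t)

/-! ### Gain conditions -/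

/-- `μ = δ` if `M = 1`, and `μ = (δ k₁ + k₂) / k₁²` if `M ≥ 2`. -/
noncomputable def muConst (M : ℕ) (k : ℕ → ℝ) (δ : ℝ) : ℝ :=
  if M = 1 then δ else (δ * k 1 + k 2) / k 1 ^ 2

/-- The gain ratios `c_l = k_{l+1} / k_l`. -/
noncomputable def gainRatio (k : ℕ → ℝ) (l : ℕ) : ℝ := k (l + 1) / k l

/-- The entry in row `i` and column `j` of the gain matrix, with `1 ≤ i, j ≤ M`. -/
noncomputable def sigmaEntry (M : ℕ) (k : ℕ → ℝ) (δ : ℝ) (i j : ℕ) : ℝ :=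
  if i = 1 then gainRatio k (M - 1)
  else if i ≤ j ∧ i < M then gainRatio k (M - i) - gainRatio k (M - i + 1)
  else if i = j + 1 then - gainRatio k (M - j)
  else if i = M ∧ j = M then δ
  else 0

/-- The gain matrix `Σ`. -/
noncomputable def sigmaBar (M : ℕ) (k : ℕ → ℝ) (δ : ℝ) : Matrix (Fin M) (Fin M) ℝ :=
  Matrix.of fun i j => sigmaEntry M k δ ((i : ℕ) + 1) ((j : ℕ) + 1)

/-- `Q = Σ + Σᵀ`. -/
noncomputable def qBar (M : ℕ) (k : ℕ → ℝ) (δ : ℝ) : Matrix (Fin M) (Fin M) ℝ :=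
  sigmaBar M k δ + (sigmaBar M k δ).transpose

end BearingObserver

/-! Divide the error components of each agent by the gains, `y n = e^(n) / k (n+1)`. Every component
then receives the same correction `-d i`, so after passing to the increments `y n - y (n-1)` the
correction survives only in the increment with index 0. The Lyapunov function is the sum of the
squared norms of all increments over all agents. Its derivative along the errors has three
contributions.

The correction contributes a negative term, controlled by `correction_coercive`: the operator formed
by the bearing projections and `α` times the Laplacian is bounded below by `μ`. Split the position
errors into their mean and the disagreement. Spatial excitation controls the mean, the spectral gap
of the Laplacian controls the disagreement, and the cross terms are absorbed by a Young inequality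
with parameter `γ`. The condition on `α` is what this balance requires.

The chain of integrators contributes a quadratic form in the increments. For `M ≥ 2`, after spending
`k 1 * μ = δ + k 2 / k 1` of the coercivity on `y 0`, this form is minus that of the gain matrix
`sigmaBar` with the order of the increments reversed (`sum_sigmaEntry_mul_increment`,
`exists_dissipation`); positive definiteness of `qBar` makes it dissipative.

The target input enters only the last increment, and half of the dissipation absorbs it. Grönwall's
inequality and the equivalence of the Lyapunov function with the squared norm give
`exists_error_estimate`, one affine bound whose constants are fixed before the initial time, the
trajectories and the input. Both stability claims are read off from it, the exponential one with
input bound zero. Solutions exist globally because the observer is Lipschitz in the estimates with a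
constant independent of time. -/

namespace BearingObserver

/-! ### Global solutions of uniformly Lipschitz differential equations -/

section GlobalExistence

variable {E : Type*} [NormedAddCommGroup E] [NormedSpace ℝ E]

/-- A solution on `[a, c]` and a solution on `[c, d]` with the same value at `c` can be glued. -/
theorem hasDerivWithinAt_glue {f : ℝ → E → E} {y z : ℝ → E} {a c d : ℝ} (hac : a ≤ c)
    (hcd : c ≤ d) (hyz : y c = z c)
    (hy : ∀ t ∈ Set.Icc a c, HasDerivWithinAt y (f t (y t)) (Set.Icc a c) t)
    (hz : ∀ t ∈ Set.Icc c d, HasDerivWithinAt z (f t (z t)) (Set.Icc c d) t) :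
    ∀ t ∈ Set.Icc a d, HasDerivWithinAt (fun τ => if τ ≤ c then y τ else z τ)
      (f t (if t ≤ c then y t else z t)) (Set.Icc a d) t := by
  intro t ht
  set g : ℝ → E := fun τ => if τ ≤ c then y τ else z τ with hg
  have gy : ∀ τ ∈ Set.Icc a c, g τ = y τ := fun τ hτ => if_pos hτ.2
  have gz : ∀ τ ∈ Set.Icc c d, g τ = z τ := by
    intro τ hτ
    rcases hτ.1.eq_or_lt with h | h
    · subst h; simp [hg, hyz]
    · exact if_neg (not_le.2 h)
  have h1 : HasDerivWithinAt g (f t (g t)) (Set.Icc a c) t := by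
    by_cases h : t ∈ Set.Icc a c
    · rw [gy t h]
      exact (hy t h).congr gy (gy t h)
    -- Away from the closed interval every vector is vacuously a derivative within it, so the two
    -- one-piece statements can be united at every `t`.
    · exact HasFDerivWithinAt.of_notMem_closure (by rwa [isClosed_Icc.closure_eq])
  have h2 : HasDerivWithinAt g (f t (g t)) (Set.Icc c d) t := by
    by_cases h : t ∈ Set.Icc c d
    · rw [gz t h]
      exact (hz t h).congr gz (gz t h)
    · exact HasFDerivWithinAt.of_notMem_closure (by rwa [isClosed_Icc.closure_eq])
  have := h1.union h2
  rwa [Set.Icc_union_Icc_eq_Icc hac hcd] at this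

variable [CompleteSpace E]

/-- A vector field that is `K`-Lipschitz in the state has solutions on time intervals whose length
depends only on `K`. -/
theorem exists_solution_Icc_of_lipschitz {f : ℝ → E → E} {K : NNReal} {a h : ℝ} (hh : 0 ≤ h)
    (hKh : K * h ≤ 1 / 2) (hh1 : h ≤ 1 / 2)
    (hlip : ∀ t ∈ Set.Icc a (a + h), LipschitzWith K (f t))
    (hcont : ∀ x, ContinuousOn (fun t => f t x) (Set.Icc a (a + h))) (x₀ : E) :
    ∃ y : ℝ → E, y a = x₀ ∧
      ∀ t ∈ Set.Icc a (a + h), HasDerivWithinAt y (f t (y t)) (Set.Icc a (a + h)) t := by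
  obtain ⟨B, hB⟩ := isCompact_Icc.exists_bound_of_continuousOn (hcont x₀)
  have haI : a ∈ Set.Icc a (a + h) := ⟨le_rfl, by linarith⟩
  have hB0 : 0 ≤ B := (norm_nonneg _).trans (hB a haI)
  -- The ball has radius `B`, the bound of `f t x₀`. On it the field is at most `B + K * B`, and `(B
  -- + K * B) * h ≤ B` by the two bounds on `h`; a larger `x₀` therefore does not shorten the
  -- interval.
  have key : IsPicardLindelof f (tmin := a) (tmax := a + h) ⟨a, haI⟩ x₀ ⟨B, hB0⟩ 0
      (⟨B, hB0⟩ + K * ⟨B, hB0⟩) K := by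
    refine ⟨fun t ht => (hlip t ht).lipschitzOnWith, fun x _ => hcont x, fun t ht x hx => ?_, ?_⟩
    · have h1 := (hlip t ht).dist_le_mul x x₀
      have h2 : dist x x₀ ≤ B := hx
      have h3 : ‖f t x‖ ≤ ‖f t x₀‖ + dist (f t x) (f t x₀) := by
        rw [dist_eq_norm]
        calc ‖f t x‖ = ‖f t x₀ + (f t x - f t x₀)‖ := by congr 1; abel
          _ ≤ _ := norm_add_le _ _
      have h4 := hB t ht
      have h5 : (K : ℝ) * dist x x₀ ≤ K * B := by gcongr
      change _ ≤ B + K * B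
      linarith
    · push_cast
      change (B + K * B) * max (a + h - a) (a - a) ≤ B - 0
      rw [add_sub_cancel_left, sub_self, max_eq_left hh]
      nlinarith
  exact key.exists_eq_forall_mem_Icc_hasDerivWithinAt₀

/-- A vector field that is continuous in time and Lipschitz in the state, with a constant that does
not depend on time, has a global forward solution through every initial state. -/
theorem exists_solution_Ici_of_lipschitz {f : ℝ → E → E} {K : NNReal} {s : ℝ}
    (hlip : ∀ t, s ≤ t → LipschitzWith K (f t))
    (hcont : ∀ x, ContinuousOn (fun t => f t x) (Set.Ici s)) (x₀ : E) :
    ∃ y : ℝ → E, y s = x₀ ∧ ∀ t, s ≤ t → HasDerivWithinAt y (f t (y t)) (Set.Ici s) t := by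
  obtain ⟨h, hh, hKh, hh1⟩ : ∃ h : ℝ, 0 < h ∧ K * h ≤ 1 / 2 ∧ h ≤ 1 / 2 := by
    have hK : (0 : ℝ) ≤ K := K.2
    refine ⟨1 / (2 * (K + 1)), by positivity, ?_, ?_⟩
    · rw [mul_one_div, div_le_div_iff₀ (by positivity) (by positivity)]; linarith
    · rw [div_le_div_iff₀ (by positivity) (by positivity)]; linarith
  have step : ∀ (n : ℕ) (x : E), ∃ y : ℝ → E, y (s + n * h) = x ∧
      ∀ t ∈ Set.Icc (s + n * h) (s + n * h + h),
        HasDerivWithinAt y (f t (y t)) (Set.Icc (s + n * h) (s + n * h + h)) t := by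
    intro n x
    have hn : (0 : ℝ) ≤ n * h := by positivity
    exact exists_solution_Icc_of_lipschitz hh.le hKh hh1
      (fun t ht => hlip t (by linarith [ht.1]))
      (fun x => (hcont x).mono fun t ht => by
        simp only [Set.mem_Ici]; linarith [ht.1]) x
  choose y hy0 hy using step
  -- `F n` solves the equation on `[s, s + n * h]`; the next function continues it by the local
  -- solution that starts from its endpoint value.
  let F : ℕ → ℝ → E := fun n => Nat.rec (fun _ => x₀)
    (fun n g τ => if τ ≤ s + n * h then g τ else y n (g (s + n * h)) τ) n
  have Fsucc : ∀ n τ, F (n + 1) τ =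
      if τ ≤ s + n * h then F n τ else y n (F n (s + n * h)) τ := fun n τ => rfl
  have Fs : ∀ n, F n s = x₀ := by
    intro n
    induction n with
    | zero => rfl
    | succ n ih =>
      have : (0 : ℝ) ≤ n * h := by positivity
      rw [Fsucc, if_pos (by linarith), ih]
  have Fderiv : ∀ n : ℕ, ∀ t ∈ Set.Icc s (s + n * h),
      HasDerivWithinAt (F n) (f t (F n t)) (Set.Icc s (s + n * h)) t := by
    intro n
    induction n with
    | zero =>
      intro t _
      exact HasFDerivWithinAt.of_subsingleton (by simp)
    | succ n ih =>
      have hn0 : (0 : ℝ) ≤ n * h := by positivity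
      have := hasDerivWithinAt_glue (f := f) (a := s) (c := s + n * h) (d := s + n * h + h)
        (by linarith) (by linarith) (hy0 n (F n (s + n * h))).symm ih (hy n _)
      have e : s + ((n + 1 : ℕ) : ℝ) * h = s + n * h + h := by push_cast; ring
      rw [e]
      exact this
  have Fmono : ∀ m n : ℕ, m ≤ n → ∀ τ, τ ≤ s + m * h → F n τ = F m τ := by
    intro m n hmn τ hτ
    induction n, hmn using Nat.le_induction with
    | base => rfl
    | succ n hn ih =>
      have : (m : ℝ) * h ≤ n * h := by gcongr
      rw [Fsucc, if_pos (by linarith), ih]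
  have hex : ∀ t : ℝ, ∃ n : ℕ, t < s + n * h := by
    intro t
    obtain ⟨n, hn⟩ := exists_nat_gt ((t - s) / h)
    exact ⟨n, by rw [div_lt_iff₀ hh] at hn; linarith⟩
  -- The strict inequality `t < s + n t * h` places a whole neighbourhood of `t` where the limit
  -- function coincides with `F (n t)`, so derivatives carry over.
  choose n hn using hex
  have hagree : ∀ (m : ℕ) (τ : ℝ), τ < s + m * h → F (n τ) τ = F m τ := by
    intro m τ hτ
    rcases le_total m (n τ) with hle | hle
    · exact Fmono _ _ hle _ hτ.le
    · exact (Fmono _ _ hle _ (hn τ).le).symm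
  refine ⟨fun τ => F (n τ) τ, Fs _, fun t ht => ?_⟩
  have hd := Fderiv (n t) t ⟨ht, (hn t).le⟩
  have hd' : HasDerivWithinAt (F (n t)) (f t (F (n t) t)) (Set.Ici s) t := by
    refine hd.mono_of_mem_nhdsWithin ?_
    have : Set.Iio (s + n t * h) ∈ 𝓝 t := Iio_mem_nhds (hn t)
    filter_upwards [self_mem_nhdsWithin, nhdsWithin_le_nhds this] with τ h1 h2
    exact ⟨h1, le_of_lt h2⟩
  refine hd'.congr_of_eventuallyEq ?_ rfl
  filter_upwards [nhdsWithin_le_nhds (Iio_mem_nhds (hn t))] with τ hτ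
  exact hagree _ _ hτ

end GlobalExistence

/-! ### The spectral gap of the Laplacian -/

section Laplacian

variable {N : ℕ} {G : SimpleGraph (Fin N)} {A : Matrix (Fin N) (Fin N) ℝ}

theorem IsWeightedAdjacency.nonneg (hA : IsWeightedAdjacency G A) (i j : Fin N) : 0 ≤ A i j := by
  by_cases h : G.Adj i j
  · exact (hA.pos i j h).le
  · exact (hA.zero i j h).ge

theorem laplacian_isSymm (hA : IsWeightedAdjacency G A) : (laplacian A).IsSymm := by
  refine Matrix.IsSymm.ext fun i j => ?_
  simp only [laplacian, Matrix.of_apply]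
  by_cases h : i = j
  · subst h; simp
  · rw [if_neg h, if_neg (Ne.symm h), hA.symm.apply]

theorem laplacian_mulVec (hA : IsWeightedAdjacency G A) (x : Fin N → ℝ) (i : Fin N) :
    (laplacian A).mulVec x i = ∑ j, A i j * (x i - x j) := by
  have hii : A i i = 0 := hA.zero i i (G.loopless.irrefl i)
  have h : ∀ j, laplacian A i j * x j =
      (if i = j then (∑ l, A i l) * x j else 0) - A i j * x j := by
    intro j
    simp only [laplacian, Matrix.of_apply]
    split_ifs with hij
    · subst hij; rw [hii]; ring
    · ring
  simp only [Matrix.mulVec, dotProduct, h, Finset.sum_sub_distrib, Finset.sum_ite_eq,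
    Finset.mem_univ, if_true, mul_sub, Finset.sum_mul]

/-- The Dirichlet form of the weighted graph. -/
theorem dotProduct_laplacian_mulVec (hA : IsWeightedAdjacency G A) (x : Fin N → ℝ) :
    x ⬝ᵥ (laplacian A).mulVec x = (∑ i, ∑ j, A i j * (x i - x j) ^ 2) / 2 := by
  have h1 : x ⬝ᵥ (laplacian A).mulVec x = ∑ i, ∑ j, A i j * (x i * (x i - x j)) := by
    simp only [dotProduct, laplacian_mulVec hA, Finset.mul_sum]
    exact Finset.sum_congr rfl fun i _ => Finset.sum_congr rfl fun j _ => by ring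
  have h2 : x ⬝ᵥ (laplacian A).mulVec x = ∑ i, ∑ j, A i j * (x j * (x j - x i)) := by
    rw [h1, Finset.sum_comm]
    exact Finset.sum_congr rfl fun i _ => Finset.sum_congr rfl fun j _ => by
      rw [hA.symm.apply]
  have h3 : ∑ i, ∑ j, A i j * (x i - x j) ^ 2 =
      ∑ i, ∑ j, A i j * (x i * (x i - x j)) + ∑ i, ∑ j, A i j * (x j * (x j - x i)) := by
    simp only [← Finset.sum_add_distrib]
    exact Finset.sum_congr rfl fun i _ => Finset.sum_congr rfl fun j _ => by ring
  rw [h3, ← h1, ← h2]; ring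

theorem dotProduct_laplacian_mulVec_nonneg (hA : IsWeightedAdjacency G A) (x : Fin N → ℝ) :
    0 ≤ x ⬝ᵥ (laplacian A).mulVec x := by
  rw [dotProduct_laplacian_mulVec hA]
  exact div_nonneg (Finset.sum_nonneg fun i _ => Finset.sum_nonneg fun j _ =>
    mul_nonneg (hA.nonneg i j) (sq_nonneg _)) zero_le_two

/-- On a connected graph the kernel of the Laplacian consists of the constant vectors. -/
theorem eq_of_laplacian_mulVec_eq_zero (hG : G.Connected) (hA : IsWeightedAdjacency G A)
    {x : Fin N → ℝ} (hx : (laplacian A).mulVec x = 0) (i j : Fin N) : x i = x j := by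
  have h0 := dotProduct_laplacian_mulVec hA x
  rw [hx, dotProduct_zero] at h0
  have hnn : ∀ i j, 0 ≤ A i j * (x i - x j) ^ 2 := fun i j =>
    mul_nonneg (hA.nonneg i j) (sq_nonneg _)
  have hs : ∑ i, ∑ j, A i j * (x i - x j) ^ 2 = 0 := by linarith
  have hadj : ∀ i j, G.Adj i j → x i = x j := by
    intro i j hij
    have h1 := (Finset.sum_eq_zero_iff_of_nonneg
      (fun i _ => Finset.sum_nonneg fun j _ => hnn i j)).1 hs i (Finset.mem_univ _)
    have h2 := (Finset.sum_eq_zero_iff_of_nonneg (fun j _ => hnn i j)).1 h1 j (Finset.mem_univ _)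
    have h3 := (mul_eq_zero.1 h2).resolve_left (hA.pos i j hij).ne'
    exact sub_eq_zero.1 (pow_eq_zero_iff two_ne_zero |>.1 h3)
  obtain ⟨w⟩ := hG.preconnected i j
  induction w with
  | nil => rfl
  | cons h _ ih => exact (hadj _ _ h).trans ih

/-- Spectral expansion of a quadratic form, compared with a multiple of the norm. -/
theorem mul_dotProduct_le_of_eigenvalues {L : Matrix (Fin N) (Fin N) ℝ} (hL : L.IsHermitian)
    {l : ℝ} {x : Fin N → ℝ}
    (h : ∀ m, (hL.eigenvectorBasis m).ofLp ⬝ᵥ x ≠ 0 → l ≤ hL.eigenvalues m) :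
    l * (x ⬝ᵥ x) ≤ x ⬝ᵥ L.mulVec x := by
  have hin : ∀ a b : EuclideanSpace ℝ (Fin N), inner ℝ a b = a.ofLp ⬝ᵥ b.ofLp := by
    intro a b
    rw [EuclideanSpace.inner_eq_star_dotProduct]
    simp [dotProduct_comm]
  have hexp : ∀ y : Fin N → ℝ, x ⬝ᵥ y =
      ∑ m, (x ⬝ᵥ (hL.eigenvectorBasis m).ofLp) * ((hL.eigenvectorBasis m).ofLp ⬝ᵥ y) := by
    intro y
    have := hL.eigenvectorBasis.sum_inner_mul_inner (WithLp.toLp 2 x) (WithLp.toLp 2 y)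
    simp only [hin] at this
    exact this.symm
  have hev : ∀ m, (hL.eigenvectorBasis m).ofLp ⬝ᵥ L.mulVec x =
      hL.eigenvalues m * ((hL.eigenvectorBasis m).ofLp ⬝ᵥ x) := by
    intro m
    have hT : L.transpose = L := by
      rw [← Matrix.conjTranspose_eq_transpose_of_trivial]; exact hL
    rw [Matrix.dotProduct_mulVec, ← Matrix.mulVec_transpose, hT, hL.mulVec_eigenvectorBasis,
      smul_dotProduct, smul_eq_mul]
  rw [hexp x, hexp (L.mulVec x), Finset.mul_sum]
  refine Finset.sum_le_sum fun m _ => ?_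
  rw [hev, dotProduct_comm x]
  by_cases h0 : (hL.eigenvectorBasis m).ofLp ⬝ᵥ x = 0
  · simp [h0]
  · nlinarith [h m h0, mul_self_nonneg ((hL.eigenvectorBasis m).ofLp ⬝ᵥ x)]

theorem laplacian_isHermitian (hA : IsWeightedAdjacency G A) : (laplacian A).IsHermitian := by
  rw [Matrix.IsHermitian, Matrix.conjTranspose_eq_transpose_of_trivial]
  exact laplacian_isSymm hA

/-- Eigenvectors of the Laplacian that are not orthogonal to some vector with zero sum belong to
positive eigenvalues. -/
theorem laplacian_eigenvalue_mem (hG : G.Connected) (hA : IsWeightedAdjacency G A)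
    {x : Fin N → ℝ} (hx : ∑ i, x i = 0) (m : Fin N)
    (hm : ((laplacian_isHermitian hA).eigenvectorBasis m).ofLp ⬝ᵥ x ≠ 0) :
    (laplacian_isHermitian hA).eigenvalues m ∈
      {l : ℝ | 0 < l ∧ Module.End.HasEigenvalue (Matrix.toLin' (laplacian A)) l} := by
  set hL := laplacian_isHermitian hA
  set v := (hL.eigenvectorBasis m).ofLp with hv
  have hmul : (laplacian A).mulVec v = hL.eigenvalues m • v := hL.mulVec_eigenvectorBasis m
  have hv0 : v ≠ 0 := fun h => hm (by rw [h, zero_dotProduct])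
  have hvv : 0 < v ⬝ᵥ v := by
    have h1 : 0 ≤ v ⬝ᵥ v := Finset.sum_nonneg fun i _ => mul_self_nonneg _
    exact lt_of_le_of_ne h1 fun h => hv0 (dotProduct_self_eq_zero.1 h.symm)
  have hnn : 0 ≤ hL.eigenvalues m := by
    have := dotProduct_laplacian_mulVec_nonneg hA v
    rw [hmul, dotProduct_smul, smul_eq_mul] at this
    exact nonneg_of_mul_nonneg_left this hvv
  have hne : hL.eigenvalues m ≠ 0 := by
    intro h0
    rw [h0, zero_smul] at hmul
    apply hm
    -- A kernel vector is constant by connectedness, hence orthogonal to the zero-sum vector `x`,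
    -- against `hm`.
    have hc := eq_of_laplacian_mulVec_eq_zero hG hA hmul
    have : ∀ i, v i * x i = v m * x i := fun i => by rw [hc i m]
    simp only [dotProduct, this, ← Finset.mul_sum, hx, mul_zero]
  refine ⟨lt_of_le_of_ne hnn (Ne.symm hne), ?_⟩
  exact Module.End.hasEigenvalue_of_hasEigenvector (x := v)
    (Module.End.hasEigenvector_iff.2 ⟨Module.End.mem_eigenspace_iff.2 (by
      rw [Matrix.toLin'_apply, hmul]), hv0⟩)

/-- The real infimum of the empty set is `0`, so a positive eigenvalue must be exhibited; finiteness
of the spectrum then makes the infimum attained. -/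
theorem minPosEigenvalue_laplacian_pos (hN : 2 ≤ N) (hG : G.Connected)
    (hA : IsWeightedAdjacency G A) : 0 < minPosEigenvalue (laplacian A) := by
  have hne : {l : ℝ | 0 < l ∧
      Module.End.HasEigenvalue (Matrix.toLin' (laplacian A)) l}.Nonempty := by
    let a : Fin N := ⟨0, by omega⟩
    let b : Fin N := ⟨1, by omega⟩
    have hab : a ≠ b := by simp [a, b, Fin.ext_iff]
    let x : Fin N → ℝ := Pi.single a 1 - Pi.single b 1
    have hx : ∑ i, x i = 0 := by simp [x, Finset.sum_sub_distrib]
    have hx0 : x ≠ 0 := by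
      intro h
      have := congrFun h a
      simp [x, hab] at this
    by_contra hemp
    have hno : ∀ m, ((laplacian_isHermitian hA).eigenvectorBasis m).ofLp ⬝ᵥ x = 0 := by
      intro m
      by_contra hm
      exact hemp ⟨_, laplacian_eigenvalue_mem hG hA hx m hm⟩
    -- Without positive eigenvalues the zero-sum vector `x` would be orthogonal to the whole
    -- eigenbasis, and the spectral bound would hold for every `l`. Taking `l` one above the
    -- Rayleigh quotient of `x` is absurd.
    have h1 := mul_dotProduct_le_of_eigenvalues (laplacian_isHermitian hA)
      (l := dotProduct x ((laplacian A).mulVec x) / dotProduct x x + 1) (x := x)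
      fun m hm => absurd (hno m) hm
    have h2 : 0 < x ⬝ᵥ x := lt_of_le_of_ne (Finset.sum_nonneg fun i _ => mul_self_nonneg _)
      fun h => hx0 (dotProduct_self_eq_zero.1 h.symm)
    rw [add_mul, div_mul_cancel₀ _ h2.ne'] at h1
    linarith
  have hfin : {l : ℝ | 0 < l ∧ Module.End.HasEigenvalue (Matrix.toLin' (laplacian A)) l}.Finite :=
    (Module.End.finite_hasEigenvalue (Matrix.toLin' (laplacian A))).subset fun l hl => hl.2
  exact (hne.csInf_mem hfin).1

/-- The spectral gap inequality on vectors with zero sum. -/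
theorem minPosEigenvalue_mul_le (hG : G.Connected) (hA : IsWeightedAdjacency G A)
    {x : Fin N → ℝ} (hx : ∑ i, x i = 0) :
    minPosEigenvalue (laplacian A) * ∑ i, x i ^ 2 ≤
      ∑ i, x i * ∑ j, A i j * (x i - x j) := by
  have h := mul_dotProduct_le_of_eigenvalues (laplacian_isHermitian hA)
    (l := minPosEigenvalue (laplacian A)) (x := x) fun m hm =>
      csInf_le ⟨0, fun l hl => hl.1.le⟩ (laplacian_eigenvalue_mem hG hA hx m hm)
  simpa only [dotProduct, laplacian_mulVec hA, ← sq] using h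

/-- The spectral gap inequality for families of points of `ℝ³` with zero sum. -/
theorem minPosEigenvalue_mul_norm_le (hG : G.Connected) (hA : IsWeightedAdjacency G A)
    {w : Fin N → Space} (hw : ∑ i, w i = 0) :
    minPosEigenvalue (laplacian A) * ∑ i, ‖w i‖ ^ 2 ≤
      ∑ i, inner ℝ (w i) (∑ j, A i j • (w i - w j)) := by
  have hc : ∀ l : Fin 3, ∑ i, (w i) l = 0 := by
    intro l
    have := congrArg (fun v : Space => v l) hw
    simpa using this
  have h := Finset.sum_le_sum fun (l : Fin 3) (_ : l ∈ Finset.univ) =>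
    minPosEigenvalue_mul_le hG hA (hc l)
  rw [← Finset.mul_sum, Finset.sum_comm, Finset.sum_comm (s := Finset.univ (α := Fin 3))] at h
  have h1 : ∑ i, ‖w i‖ ^ 2 = ∑ i, ∑ l, (w i) l ^ 2 :=
    Finset.sum_congr rfl fun i _ => EuclideanSpace.real_norm_sq_eq _
  have h2 : ∑ i, inner ℝ (w i) (∑ j, A i j • (w i - w j)) =
      ∑ i, ∑ l, (w i) l * ∑ j, A i j * ((w i) l - (w j) l) := by
    refine Finset.sum_congr rfl fun i _ => ?_
    rw [PiLp.inner_apply]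
    refine Finset.sum_congr rfl fun l _ => ?_
    simp [mul_comm]
  rw [h1, h2]
  exact h

end Laplacian

/-! ### Bearing projections and the coercivity of the correction -/

theorem act_proj (b v : Space) : act (proj b) v = v - inner ℝ b v • b := by
  ext i
  simp only [act, proj, Matrix.sub_mulVec, Matrix.one_mulVec, Matrix.vecMulVec_mulVec]
  simp [EuclideanSpace.inner_eq_star_dotProduct, dotProduct_comm]

theorem norm_bearing {p q : Space} (h : q ≠ p) : ‖bearing p q‖ = 1 := by
  have : ‖q - p‖ ≠ 0 := norm_ne_zero_iff.2 (sub_ne_zero.2 h)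
  rw [bearing, norm_smul, norm_inv, norm_norm, inv_mul_cancel₀ this]

theorem act_sub (Q : Matrix (Fin 3) (Fin 3) ℝ) (v w : Space) :
    act Q (v - w) = act Q v - act Q w := by
  ext i
  simp [act, Matrix.mulVec_sub]

theorem act_proj_bearing_sub {p q : Space} (h : q ≠ p) : act (proj (bearing p q)) (q - p) = 0 := by
  have h0 : ‖q - p‖ ≠ 0 := norm_ne_zero_iff.2 (sub_ne_zero.2 h)
  rw [act_proj, bearing, real_inner_smul_left, real_inner_self_eq_norm_sq, smul_smul]
  have : ‖q - p‖⁻¹ * ‖q - p‖ ^ 2 * ‖q - p‖⁻¹ = 1 := by field_simp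
  rw [this, one_smul, sub_self]

/-- The measurement of an agent is the projection of the target position. -/
theorem act_proj_bearing_eq {p q : Space} (h : q ≠ p) :
    act (proj (bearing p q)) p = act (proj (bearing p q)) q := by
  have := act_proj_bearing_sub h
  rw [act_sub] at this
  exact (sub_eq_zero.1 this).symm

/-- The lower bound for the correction operator, for arbitrary unit bearings `b i` whose
projections are spatially exciting. -/
theorem correction_coercive {N : ℕ} {G : SimpleGraph (Fin N)} {A : Matrix (Fin N) (Fin N) ℝ}
    (hN : 2 ≤ N) (hG : G.Connected) (hA : IsWeightedAdjacency G A) {α μ γ : ℝ} (hμ : 0 < μ)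
    (hγ : 0 < γ) (hα : 0 < α) (hαγ : α > (μ + 1 / γ - 1) / minPosEigenvalue (laplacian A))
    {b : Fin N → Space} (hb : ∀ i, ‖b i‖ = 1)
    (hexc : ((1 / (N : ℝ)) • ∑ i, proj (b i) -
      (μ + γ) • (1 : Matrix (Fin 3) (Fin 3) ℝ)).PosDef) (v : Fin N → Space) :
    μ * ∑ i, ‖v i‖ ^ 2 ≤
      ∑ i, inner ℝ (v i) (act (proj (b i)) (v i) + α • ∑ j, A i j • (v i - v j)) := by
  have hNpos : (0 : ℝ) < N := by exact_mod_cast (by omega : 0 < N)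
  have hB : ∀ i (x : Space), inner ℝ x (act (proj (b i)) x) = ‖x‖ ^ 2 - inner ℝ (b i) x ^ 2 := by
    intro i x
    rw [act_proj, inner_sub_right, real_inner_smul_right, real_inner_self_eq_norm_sq,
      real_inner_comm x]
    ring
  have hBnn : ∀ i (x : Space), inner ℝ (b i) x ^ 2 ≤ ‖x‖ ^ 2 := by
    intro i x
    have := abs_real_inner_le_norm (b i) x
    rw [hb, one_mul] at this
    exact sq_le_sq' (neg_le_of_abs_le this) (le_of_abs_le this)
  have hex : ∀ x : Space, (μ + γ) * N * ‖x‖ ^ 2 ≤ ∑ i, (‖x‖ ^ 2 - inner ℝ (b i) x ^ 2) := by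
    intro x
    have h := hexc.posSemidef.dotProduct_mulVec_nonneg x.ofLp
    have hS : ∀ (s : Finset (Fin N)), x.ofLp ⬝ᵥ (∑ i ∈ s, proj (b i)).mulVec x.ofLp =
        ∑ i ∈ s, (‖x‖ ^ 2 - inner ℝ (b i) x ^ 2) := by
      intro s
      rw [Matrix.sum_mulVec, dotProduct_sum]
      refine Finset.sum_congr rfl fun i _ => ?_
      rw [← hB, EuclideanSpace.inner_eq_star_dotProduct, dotProduct_comm]
      simp [act]
    have hxx : x.ofLp ⬝ᵥ x.ofLp = ‖x‖ ^ 2 := by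
      rw [← real_inner_self_eq_norm_sq, EuclideanSpace.inner_eq_star_dotProduct]; simp
    simp only [star_trivial, Matrix.sub_mulVec, Matrix.smul_mulVec, Matrix.one_mulVec,
      dotProduct_sub, dotProduct_smul, hS, hxx, smul_eq_mul] at h
    rw [one_div, sub_nonneg, inv_mul_eq_div, le_div_iff₀ hNpos] at h
    linarith
  -- An average of projections is at most the identity; testing the excitation on one unit vector
  -- gives `μ + γ ≤ 1`.
  have hγ1 : γ < 1 := by
    have h := hex (EuclideanSpace.single 0 1)
    have h1 : ‖(EuclideanSpace.single 0 1 : Space)‖ = 1 := by simp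
    have h2 : ∑ i, (‖(EuclideanSpace.single 0 1 : Space)‖ ^ 2 -
        inner ℝ (b i) (EuclideanSpace.single 0 1) ^ 2) ≤ ∑ _i : Fin N, (1 : ℝ) :=
      Finset.sum_le_sum fun i _ => by rw [h1]; nlinarith [sq_nonneg (inner ℝ (b i)
        (EuclideanSpace.single 0 1 : Space))]
    rw [h1] at h h2
    simp only [one_pow, mul_one, Finset.sum_const, Finset.card_univ, Fintype.card_fin,
      nsmul_eq_mul] at h h2
    have := h.trans h2
    nlinarith
  -- `a` is the mean of the errors and `w` the disagreement. The Laplacian sees only `w`, while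
  -- excitation is available only for a vector common to all agents, such as `a`.
  set a : Space := (1 / (N : ℝ)) • ∑ i, v i with ha
  set w : Fin N → Space := fun i => v i - a with hw
  have hNa : (N : ℝ) • a = ∑ i, v i := by
    rw [ha, smul_smul, mul_one_div_cancel hNpos.ne', one_smul]
  have hw0 : ∑ i, w i = 0 := by
    simp only [hw, Finset.sum_sub_distrib, Finset.sum_const, Finset.card_univ, Fintype.card_fin,
      ← Nat.cast_smul_eq_nsmul ℝ, hNa, sub_self]
  have hvw : ∀ i, v i = a + w i := fun i => by simp [hw]
  have hnorm : ∑ i, ‖v i‖ ^ 2 = N * ‖a‖ ^ 2 + ∑ i, ‖w i‖ ^ 2 := by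
    have : ∀ i, ‖v i‖ ^ 2 = ‖a‖ ^ 2 + 2 * inner ℝ a (w i) + ‖w i‖ ^ 2 := fun i => by
      rw [hvw i, norm_add_sq_real]
    simp only [this, Finset.sum_add_distrib, ← Finset.mul_sum, ← inner_sum, hw0, inner_zero_right,
      Finset.sum_const, Finset.card_univ, Fintype.card_fin, nsmul_eq_mul]
    ring
  have hlap : ∑ i, inner ℝ (v i) (∑ j, A i j • (v i - v j)) =
      ∑ i, inner ℝ (w i) (∑ j, A i j • (w i - w j)) := by
    -- Symmetry of `A` makes the couplings cancel in pairs, so pairing with the constant `a`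
    -- contributes nothing.
    have hz : ∑ i, ∑ j, A i j • (w i - w j) = 0 := by
      have h1 : ∑ i, ∑ j, A i j • (w i - w j) = - ∑ i, ∑ j, A i j • (w i - w j) := by
        conv_lhs => rw [Finset.sum_comm]
        simp only [← Finset.sum_neg_distrib]
        refine Finset.sum_congr rfl fun i _ => Finset.sum_congr rfl fun j _ => ?_
        rw [hA.symm.apply, ← smul_neg, neg_sub]
      have h2 : (2 : ℝ) • ∑ i, ∑ j, A i j • (w i - w j) = 0 := by
        rw [two_smul]
        exact add_eq_zero_iff_eq_neg.2 h1
      exact (smul_eq_zero.1 h2).resolve_left two_ne_zero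
    have h2 : ∀ i, inner ℝ (v i) (∑ j, A i j • (v i - v j)) =
        inner ℝ a (∑ j, A i j • (w i - w j)) + inner ℝ (w i) (∑ j, A i j • (w i - w j)) := by
      intro i
      rw [← inner_add_left, ← hvw]
      simp [hw]
    rw [Finset.sum_congr rfl fun i _ => h2 i, Finset.sum_add_distrib, ← inner_sum, hz,
      inner_zero_right, zero_add]
  have hgap := minPosEigenvalue_mul_norm_le hG hA hw0
  have hlpos := minPosEigenvalue_laplacian_pos hN hG hA
  set l := minPosEigenvalue (laplacian A)
  have hal : μ + 1 / γ - 1 < α * l := by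
    have := (div_lt_iff₀ hlpos).1 hαγ
    linarith
  have hpt : ∀ i, inner ℝ (v i) (act (proj (b i)) (v i)) ≥
      (‖a‖ ^ 2 - inner ℝ (b i) a ^ 2) - γ * ‖a‖ ^ 2 + (1 - 1 / γ) * ‖w i‖ ^ 2 := by
    intro i
    rw [hB, hvw, norm_add_sq_real, inner_add_right]
    -- The projection form is nonnegative at `γ • a + w i`; division by `γ` bounds the cross term
    -- below by `-γ` times the form at `a` minus `1/γ` times the form at `w i`. The form is then
    -- bounded above by the squared norm, which has the right sign at `w i` because `1 - 1/γ ≤ 0`.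
    have h1 := hBnn i (γ • a + w i)
    rw [norm_add_sq_real, inner_add_right, real_inner_smul_right, real_inner_smul_left, norm_smul,
      Real.norm_of_nonneg hγ.le] at h1
    have h2 := hBnn i (w i)
    have h4 : 2 * (inner ℝ a (w i) - inner ℝ (b i) a * inner ℝ (b i) (w i)) ≥
        - (γ * (‖a‖ ^ 2 - inner ℝ (b i) a ^ 2)) -
          1 / γ * (‖w i‖ ^ 2 - inner ℝ (b i) (w i) ^ 2) := by
      have e : - (γ * (‖a‖ ^ 2 - inner ℝ (b i) a ^ 2)) -
          1 / γ * (‖w i‖ ^ 2 - inner ℝ (b i) (w i) ^ 2) =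
          (- (γ ^ 2 * (‖a‖ ^ 2 - inner ℝ (b i) a ^ 2)) -
          (‖w i‖ ^ 2 - inner ℝ (b i) (w i) ^ 2)) / γ := by field_simp
      rw [e, ge_iff_le, div_le_iff₀ hγ]
      nlinarith
    have h5 : 1 ≤ 1 / γ := (one_le_div hγ).2 hγ1.le
    nlinarith [mul_nonneg (sub_nonneg.2 h5) (sq_nonneg (inner ℝ (b i) (w i))),
      mul_nonneg hγ.le (sq_nonneg (inner ℝ (b i) a))]
  have hsum := Finset.sum_le_sum fun i (_ : i ∈ Finset.univ) => hpt i
  simp only [Finset.sum_add_distrib, ← Finset.mul_sum, Finset.sum_sub_distrib (f := fun i =>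
    ‖a‖ ^ 2 - inner ℝ (b i) a ^ 2), Finset.sum_const, Finset.card_univ, Fintype.card_fin,
    nsmul_eq_mul] at hsum
  simp only [inner_add_right, real_inner_smul_right, Finset.sum_add_distrib, ← Finset.mul_sum]
  rw [hnorm, hlap]
  have h6 := hex a
  have h7 : 0 ≤ ∑ i, ‖w i‖ ^ 2 := Finset.sum_nonneg fun i _ => sq_nonneg _
  have h8 := mul_le_mul_of_nonneg_left hgap hα.le
  -- On the mean, `(μ + γ) - γ = μ` remains; on the disagreement, `1 - 1/γ + α * l` exceeds `μ`.
  nlinarith [mul_nonneg (sub_nonneg.2 hal.le) h7]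

/-! ### Dissipativity of the integrator chain -/

/-- The increments of a sequence, with `y (-1) = 0`. -/
def increment {V : Type*} [AddCommGroup V] (y : ℕ → V) (n : ℕ) : V :=
  y n - if n = 0 then 0 else y (n - 1)

/-- The part of the dynamics of the increments of the scaled error that does not contain the
correction. -/
noncomputable def chainDrift {V : Type*} [AddCommGroup V] [Module ℝ V] (k : ℕ → ℝ) (y : ℕ → V)
    (n : ℕ) : V :=
  gainRatio k (n + 1) • y (n + 1) - if n = 0 then 0 else gainRatio k n • y n

theorem sum_increment {V : Type*} [AddCommGroup V] (y : ℕ → V) (p : ℕ) :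
    ∑ n ∈ Finset.range (p + 1), increment y n = y p := by
  induction p with
  | zero => simp [increment]
  | succ p ih => rw [Finset.sum_range_succ, ih]; simp [increment]

theorem sum_ite_mul_increment (y : ℕ → ℝ) (c : ℝ) {p M : ℕ} (hp : p + 1 ≤ M) :
    ∑ n ∈ Finset.range M, (if n < p + 1 then c else 0) * increment y n = c * y p := by
  simp only [ite_mul, zero_mul]
  rw [← Finset.sum_filter]
  have : (Finset.range M).filter (fun n => n < p + 1) = Finset.range (p + 1) := by
    ext n; simp only [Finset.mem_filter, Finset.mem_range]; omega
  rw [this, ← Finset.mul_sum, sum_increment]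

/-- The gain matrix numbers the increments backwards, hence the indices `M - m` and `M - n`. Each
reversed row is a combination of indicators of initial segments, so its product with the increments
telescopes to values of `y`. Row `m = 0` carries the extra `δ + gainRatio k 1`, which the coercivity
of the correction has to pay for. -/
theorem sum_sigmaEntry_mul_increment {M : ℕ} (hM : 2 ≤ M) (k : ℕ → ℝ) (δ : ℝ) {y : ℕ → ℝ}
    (hy : y M = 0) {m : ℕ} (hm : m < M) :
    ∑ n ∈ Finset.range M, sigmaEntry M k δ (M - m) (M - n) * increment y n =
      - chainDrift k y m + if m = 0 then (δ + gainRatio k 1) * y 0 else 0 := by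
  by_cases hlast : m + 1 = M
  · have h1 : M - m = 1 := by omega
    have h2 : m ≠ 0 := by omega
    have h3 : M - 1 = m := by omega
    simp only [sigmaEntry, h1, if_true, ← Finset.mul_sum, h3]
    rw [← hlast, sum_increment, chainDrift, hlast, hy]
    simp [h2]
  · have hentry : ∀ n ∈ Finset.range M, sigmaEntry M k δ (M - m) (M - n) * increment y n =
        (if n < m + 1 then (if m = 0 then δ + gainRatio k 1 else gainRatio k m) else 0) *
          increment y n -
        (if n < m + 1 + 1 then gainRatio k (m + 1) else 0) * increment y n := by
      intro n hn
      rw [Finset.mem_range] at hn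
      rw [← sub_mul]
      congr 1
      have e1 : M - m ≠ 1 := by omega
      have e2 : M - (M - m) = m := by omega
      have e3 : M - (M - n) = n := by omega
      rw [sigmaEntry, if_neg e1, e2, e3]
      rcases lt_trichotomy n (m + 1) with h | h | h
      · rw [if_pos h, if_pos (by omega : n < m + 1 + 1)]
        by_cases hm0 : m = 0
        · rw [if_neg (by omega), if_neg (by omega), if_pos (by omega), if_pos hm0, hm0]
          ring
        · rw [if_pos (by omega), if_neg hm0]
      · rw [if_neg (by omega), if_pos (by omega), if_neg (by omega), if_pos (by omega), h]
        ring
      · rw [if_neg (by omega), if_neg (by omega), if_neg (by omega), if_neg (by omega),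
          if_neg (by omega)]
        ring
    rw [Finset.sum_congr rfl hentry, Finset.sum_sub_distrib,
      sum_ite_mul_increment y _ (by omega), sum_ite_mul_increment y _ (by omega), chainDrift]
    by_cases hm0 : m = 0
    · subst hm0; simp; ring
    · simp [hm0]

/-- A positive definite real matrix bounds a positive multiple of the norm. -/
theorem exists_pos_mul_le_of_posDef {M : ℕ} [NeZero M] {Q : Matrix (Fin M) (Fin M) ℝ}
    (hQ : Q.PosDef) : ∃ q : ℝ, 0 < q ∧ ∀ x : Fin M → ℝ, q * (x ⬝ᵥ x) ≤ x ⬝ᵥ Q.mulVec x := by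
  obtain ⟨m, hm⟩ := Finite.exists_min hQ.isHermitian.eigenvalues
  exact ⟨_, hQ.eigenvalues_pos m, fun x =>
    mul_dotProduct_le_of_eigenvalues hQ.isHermitian fun j _ => hm j⟩

/-- For `M = 2` the off-diagonal entries are opposite and cancel in the quadratic form, leaving the
positive diagonal `gainRatio k 1`, `δ`; this is why a matrix condition is imposed only from `M = 3`
on. -/
theorem exists_pos_mul_le_sigmaBar {M : ℕ} (hM : 2 ≤ M) {k : ℕ → ℝ} {δ : ℝ}
    (hk : ∀ m, 1 ≤ m → m ≤ M → 0 < k m) (hδ : 0 < δ) (hQ : 3 ≤ M → (qBar M k δ).PosDef) :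
    ∃ q : ℝ, 0 < q ∧ ∀ x : Fin M → ℝ, q * (x ⬝ᵥ x) ≤ x ⬝ᵥ (sigmaBar M k δ).mulVec x := by
  by_cases h3 : 3 ≤ M
  · have : NeZero M := ⟨by omega⟩
    obtain ⟨q, hq, h⟩ := exists_pos_mul_le_of_posDef (hQ h3)
    refine ⟨q / 2, by positivity, fun x => ?_⟩
    have := h x
    rw [qBar, Matrix.add_mulVec, dotProduct_add, Matrix.mulVec_transpose,
      dotProduct_comm x (Matrix.vecMul _ _), ← Matrix.dotProduct_mulVec] at this
    linarith
  · obtain rfl : M = 2 := by omega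
    have hc : 0 < gainRatio k 1 := div_pos (hk 2 (by norm_num) le_rfl) (hk 1 le_rfl (by norm_num))
    refine ⟨min (gainRatio k 1) δ, lt_min hc hδ, fun x => ?_⟩
    simp only [dotProduct, Matrix.mulVec, Fin.sum_univ_two, sigmaBar, Matrix.of_apply, sigmaEntry]
    simp
    nlinarith [mul_le_mul_of_nonneg_right (min_le_left (gainRatio k 1) δ) (mul_self_nonneg (x 0)),
      mul_le_mul_of_nonneg_right (min_le_right (gainRatio k 1) δ) (mul_self_nonneg (x 1))]

theorem muConst_pos {M : ℕ} [NeZero M] {k : ℕ → ℝ} {δ : ℝ}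
    (hk : ∀ m, 1 ≤ m → m ≤ M → 0 < k m) (hδ : 0 < δ) : 0 < muConst M k δ := by
  have hM : 1 ≤ M := NeZero.one_le
  rw [muConst]
  split_ifs with h
  · exact hδ
  · have h1 := hk 1 le_rfl hM
    have h2 := hk 2 (by norm_num) (by omega)
    positivity

/-- Dissipation inequality for a real sequence that vanishes from `M` on. -/
theorem exists_dissipation_real {M : ℕ} [NeZero M] {k : ℕ → ℝ} {δ : ℝ}
    (hk : ∀ m, 1 ≤ m → m ≤ M → 0 < k m) (hδ : 0 < δ) (hQ : 3 ≤ M → (qBar M k δ).PosDef) :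
    ∃ q : ℝ, 0 < q ∧ ∀ y : ℕ → ℝ, (∀ n, M ≤ n → y n = 0) →
      ∑ n ∈ Finset.range M, increment y n * chainDrift k y n - k 1 * muConst M k δ * y 0 ^ 2 ≤
        - q * ∑ n ∈ Finset.range M, increment y n ^ 2 := by
  have hM1 : 1 ≤ M := NeZero.one_le
  have hk1 := hk 1 le_rfl hM1
  by_cases hM : M = 1
  · subst hM
    refine ⟨k 1 * δ, by positivity, fun y hy => ?_⟩
    simp [increment, chainDrift, muConst, hy 1 le_rfl]
  · have hM2 : 2 ≤ M := by omega
    obtain ⟨q, hq, h⟩ := exists_pos_mul_le_sigmaBar hM2 hk hδ hQ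
    refine ⟨q, hq, fun y hy => ?_⟩
    have hx := h fun i => increment y (M - 1 - i)
    -- This identity dictates the value of `μ`: it supplies exactly the `y 0` term left over by the
    -- last row of the gain matrix.
    have hμ : k 1 * muConst M k δ = δ + gainRatio k 1 := by
      rw [muConst, if_neg hM, gainRatio]; field_simp
    have e1 : (fun i : Fin M => increment y (M - 1 - i)) ⬝ᵥ
        (fun i : Fin M => increment y (M - 1 - i)) =
        ∑ n ∈ Finset.range M, increment y n ^ 2 := by
      simp only [dotProduct, ← sq]
      rw [Fin.sum_univ_eq_sum_range (fun i => increment y (M - 1 - i) ^ 2) M,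
        Finset.sum_range_reflect (fun n => increment y n ^ 2)]
    have e2 : (fun i : Fin M => increment y (M - 1 - i)) ⬝ᵥ (sigmaBar M k δ).mulVec
        (fun i : Fin M => increment y (M - 1 - i)) =
        ∑ m ∈ Finset.range M, increment y m *
          ∑ n ∈ Finset.range M, sigmaEntry M k δ (M - m) (M - n) * increment y n := by
      rw [← Finset.sum_range_reflect]
      simp only [dotProduct, Matrix.mulVec, sigmaBar, Matrix.of_apply]
      rw [Fin.sum_univ_eq_sum_range (fun i => increment y (M - 1 - i) * ∑ j : Fin M,
        sigmaEntry M k δ (i + 1) (j + 1) * increment y (M - 1 - j)) M]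
      refine Finset.sum_congr rfl fun i hi => ?_
      rw [Finset.mem_range] at hi
      congr 1
      rw [Fin.sum_univ_eq_sum_range (fun j =>
        sigmaEntry M k δ (i + 1) (j + 1) * increment y (M - 1 - j)) M,
        ← Finset.sum_range_reflect (fun n =>
          sigmaEntry M k δ (M - (M - 1 - i)) (M - n) * increment y n)]
      refine Finset.sum_congr rfl fun j hj => ?_
      rw [Finset.mem_range] at hj
      rw [show M - (M - 1 - i) = i + 1 by omega, show M - (M - 1 - j) = j + 1 by omega]
    rw [e1, e2] at hx
    have e3 : ∑ m ∈ Finset.range M, increment y m *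
          ∑ n ∈ Finset.range M, sigmaEntry M k δ (M - m) (M - n) * increment y n =
        - ∑ m ∈ Finset.range M, increment y m * chainDrift k y m +
          (δ + gainRatio k 1) * y 0 ^ 2 := by
      have : ∀ m ∈ Finset.range M, increment y m *
          ∑ n ∈ Finset.range M, sigmaEntry M k δ (M - m) (M - n) * increment y n =
          - (increment y m * chainDrift k y m) +
            if m = 0 then (δ + gainRatio k 1) * y 0 ^ 2 else 0 := by
        intro m hm
        rw [sum_sigmaEntry_mul_increment hM2 k δ (hy M le_rfl) (Finset.mem_range.1 hm)]
        by_cases hm0 : m = 0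
        · subst hm0; simp [increment]; ring
        · simp [hm0]
      rw [Finset.sum_congr rfl this, Finset.sum_add_distrib, Finset.sum_neg_distrib,
        Finset.sum_ite_eq' (Finset.range M) 0, if_pos (Finset.mem_range.2 (by omega))]
    rw [e3] at hx
    rw [hμ]
    linarith

/-- Dissipation inequality for a sequence in `ℝ³` that vanishes from `M` on. -/
theorem exists_dissipation {M : ℕ} [NeZero M] {k : ℕ → ℝ} {δ : ℝ}
    (hk : ∀ m, 1 ≤ m → m ≤ M → 0 < k m) (hδ : 0 < δ) (hQ : 3 ≤ M → (qBar M k δ).PosDef) :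
    ∃ q : ℝ, 0 < q ∧ ∀ y : ℕ → Space, (∀ n, M ≤ n → y n = 0) →
      ∑ n ∈ Finset.range M, inner ℝ (increment y n) (chainDrift k y n) -
          k 1 * muConst M k δ * ‖y 0‖ ^ 2 ≤
        - q * ∑ n ∈ Finset.range M, ‖increment y n‖ ^ 2 := by
  obtain ⟨q, hq, h⟩ := exists_dissipation_real hk hδ hQ
  refine ⟨q, hq, fun y hy => ?_⟩
  -- The inequality has scalar coefficients, so it is summed over the three coordinates.
  have hs := Finset.sum_le_sum fun (l : Fin 3) (_ : l ∈ Finset.univ) =>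
    h (fun n => y n l) fun n hn => by simp [hy n hn]
  have hi : ∀ n (l : Fin 3), increment (fun n => y n l) n = (increment y n) l := by
    intro n l; by_cases hn : n = 0 <;> simp [increment, hn]
  have hd : ∀ n (l : Fin 3), chainDrift k (fun n => y n l) n = (chainDrift k y n) l := by
    intro n l; by_cases hn : n = 0 <;> simp [chainDrift, hn]
  have e1 : ∀ v w : Space, inner ℝ v w = ∑ l, v l * w l := fun v w => by
    rw [PiLp.inner_apply]
    exact Finset.sum_congr rfl fun l _ => by simp [mul_comm]
  simp only [hi, hd, Finset.sum_sub_distrib, ← Finset.mul_sum] at hs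
  rw [Finset.sum_comm, Finset.sum_comm (f := fun l n => (increment y n).ofLp l ^ 2)] at hs
  simp only [e1, EuclideanSpace.real_norm_sq_eq]
  exact hs

/-! ### Existence of observer solutions -/

theorem correction_eq {N : ℕ} (A : Matrix (Fin N) (Fin N) ℝ) (α : ℝ) {p : Fin N → Space}
    {q : Space} (phat : Fin N → Space) (i : Fin N) (h : q ≠ p i) :
    correction A α p q phat i =
      act (proj (bearing (p i) q)) (q - phat i) - α • ∑ j, A i j • (phat i - phat j) := by
  rw [correction, act_sub, act_proj_bearing_eq h, ← act_sub]

theorem norm_act_proj_le {b : Space} (hb : ‖b‖ = 1) (v : Space) : ‖act (proj b) v‖ ≤ 2 * ‖v‖ := by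
  rw [act_proj]
  have h1 := norm_sub_le v (inner ℝ b v • b)
  have h2 := norm_inner_le_norm (𝕜 := ℝ) b v
  rw [norm_smul, hb, mul_one] at h1
  rw [hb, one_mul] at h2
  linarith

theorem continuous_act : Continuous fun a : Matrix (Fin 3) (Fin 3) ℝ × Space => act a.1 a.2 :=
  (PiLp.continuous_toLp 2 _).comp
    (Continuous.matrix_mulVec continuous_fst ((PiLp.continuous_ofLp 2 _).comp continuous_snd))

/-- The constant involves neither the positions nor the agent, since bearings are unit vectors and
the weights are summed over the whole graph. This gives a Lipschitz constant uniform in time. -/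
theorem norm_correction_sub_le {N : ℕ} (A : Matrix (Fin N) (Fin N) ℝ) (α : ℝ) {p : Fin N → Space}
    {q : Space} {y z : Fin N → Space} (i : Fin N) (h : q ≠ p i) {R : ℝ}
    (hR : ∀ j, ‖y j - z j‖ ≤ R) :
    ‖correction A α p q y i - correction A α p q z i‖ ≤
      (2 + |α| * ((∑ i, ∑ j, |A i j|) * 2)) * R := by
  have hR0 : 0 ≤ R := (norm_nonneg _).trans (hR i)
  have e : correction A α p q y i - correction A α p q z i =
      - act (proj (bearing (p i) q)) (y i - z i) -
        α • ∑ j, A i j • ((y i - z i) - (y j - z j)) := by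
    have e1 : ∑ j, A i j • ((y i - z i) - (y j - z j)) =
        ∑ j, A i j • (y i - y j) - ∑ j, A i j • (z i - z j) := by
      rw [← Finset.sum_sub_distrib]
      exact Finset.sum_congr rfl fun j _ => by rw [← smul_sub]; congr 1; abel
    rw [correction, correction, e1, smul_sub, act_sub, act_sub, act_sub]
    abel
  rw [e]
  have h1 : ‖act (proj (bearing (p i) q)) (y i - z i)‖ ≤ 2 * R :=
    (norm_act_proj_le (norm_bearing h) _).trans (by linarith [hR i])
  have h2 : ‖∑ j, A i j • ((y i - z i) - (y j - z j))‖ ≤ (∑ i, ∑ j, |A i j|) * 2 * R := by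
    calc ‖∑ j, A i j • ((y i - z i) - (y j - z j))‖ ≤ ∑ j, |A i j| * (2 * R) := by
          refine norm_sum_le_of_le _ fun j _ => ?_
          rw [norm_smul, Real.norm_eq_abs]
          have := norm_sub_le (y i - z i) (y j - z j)
          have := hR i
          have := hR j
          gcongr
          linarith
      _ = (∑ j, |A i j|) * 2 * R := by rw [← Finset.sum_mul]; ring
      _ ≤ (∑ i, ∑ j, |A i j|) * 2 * R := by
          have := Finset.single_le_sum (f := fun i => ∑ j, |A i j|)
            (fun i _ => Finset.sum_nonneg fun j _ => abs_nonneg _) (Finset.mem_univ i)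
          exact mul_le_mul_of_nonneg_right (mul_le_mul_of_nonneg_right this zero_le_two) hR0
  calc _ ≤ ‖act (proj (bearing (p i) q)) (y i - z i)‖ +
        ‖α • ∑ j, A i j • ((y i - z i) - (y j - z j))‖ := by
        rw [← norm_neg (act _ _)]; exact norm_sub_le _ _
    _ ≤ 2 * R + |α| * ((∑ i, ∑ j, |A i j|) * 2 * R) := by
        rw [norm_smul, Real.norm_eq_abs]; gcongr
    _ = _ := by ring

/-- The observer has a global solution for every initial time and every initial estimate. -/
theorem exists_observerSolution {M N : ℕ} [NeZero M] (A : Matrix (Fin N) (Fin N) ℝ) (α : ℝ)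
    (k : ℕ → ℝ) {t₀ s : ℝ} (hs : t₀ ≤ s) {p : Fin N → ℝ → Space} {q : ℝ → Space}
    (hq : ContinuousOn q (Set.Ici t₀)) (hb : IsBearingSensing t₀ p q)
    (z₀ : Fin N → Fin M → Space) :
    ∃ z : ℝ → Fin N → Fin M → Space, z s = z₀ ∧ IsObserverSolution A α k p q s z := by
  let f : ℝ → (Fin N → Fin M → Space) → (Fin N → Fin M → Space) := fun t z i m =>
    (if h : (m : ℕ) + 1 < M then z i ⟨(m : ℕ) + 1, h⟩ else 0) +
      k ((m : ℕ) + 1) • correction A α (fun j => p j t) (q t) (fun j => z j 0) i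
  let κ : ℝ := ∑ m : Fin M, |k ((m : ℕ) + 1)|
  let B : ℝ := 2 + |α| * ((∑ i, ∑ j, |A i j|) * 2)
  have hκ : 0 ≤ κ := Finset.sum_nonneg fun m _ => abs_nonneg _
  have hB : 0 ≤ B := by
    have : 0 ≤ ∑ i, ∑ j, |A i j| := Finset.sum_nonneg fun i _ => Finset.sum_nonneg fun j _ =>
      abs_nonneg _
    positivity
  have hlip : ∀ t, s ≤ t → LipschitzWith ⟨1 + κ * B, by positivity⟩ (f t) := by
    intro t ht
    refine LipschitzWith.of_dist_le_mul fun y z => ?_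
    change _ ≤ (1 + κ * B) * dist y z
    rw [dist_eq_norm, dist_eq_norm]
    have hc : ∀ i m, ‖y i m - z i m‖ ≤ ‖y - z‖ := fun i m =>
      (norm_le_pi_norm ((y - z) i) m).trans (norm_le_pi_norm (y - z) i)
    refine (pi_norm_le_iff_of_nonneg (by positivity)).2 fun i =>
      (pi_norm_le_iff_of_nonneg (by positivity)).2 fun m => ?_
    have h1 : ‖(if h : (m : ℕ) + 1 < M then y i ⟨(m : ℕ) + 1, h⟩ else 0) -
        (if h : (m : ℕ) + 1 < M then z i ⟨(m : ℕ) + 1, h⟩ else 0)‖ ≤ ‖y - z‖ := by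
      split_ifs
      · exact hc _ _
      · simp
    have h2 := norm_correction_sub_le A α (p := fun j => p j t) (y := fun j => y j 0)
      (z := fun j => z j 0) i (hb.ne t (hs.trans ht) i) (fun j => hc j 0)
    have h3 : |k ((m : ℕ) + 1)| ≤ κ := Finset.single_le_sum
      (f := fun m : Fin M => |k ((m : ℕ) + 1)|) (fun m _ => abs_nonneg _) (Finset.mem_univ m)
    have e : (f t y - f t z) i m =
        ((if h : (m : ℕ) + 1 < M then y i ⟨(m : ℕ) + 1, h⟩ else 0) -
          (if h : (m : ℕ) + 1 < M then z i ⟨(m : ℕ) + 1, h⟩ else 0)) +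
        k ((m : ℕ) + 1) • (correction A α (fun j => p j t) (q t) (fun j => y j 0) i -
          correction A α (fun j => p j t) (q t) (fun j => z j 0) i) := by
      simp only [f, Pi.sub_apply, smul_sub]; abel
    rw [e]
    refine (norm_add_le _ _).trans ?_
    rw [norm_smul, Real.norm_eq_abs, add_mul, one_mul, mul_assoc]
    gcongr
  have hcont : ∀ z, ContinuousOn (fun t => f t z) (Set.Ici s) := by
    intro z
    have hsub : Set.Ici s ⊆ Set.Ici t₀ := Set.Ici_subset_Ici.2 hs
    refine continuousOn_pi.2 fun i => continuousOn_pi.2 fun m => ?_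
    refine continuousOn_const.add (ContinuousOn.fun_const_smul ?_ _)
    -- The agents' positions need not be continuous in time. Replacing the projected position of the
    -- agent by that of the target leaves only functions known to be continuous.
    refine ContinuousOn.congr (f := fun t => act (proj (bearing (p i t) (q t))) (q t - z i 0) -
      α • ∑ j, A i j • (z i 0 - z j 0)) ?_ fun t ht =>
        correction_eq A α _ i (hb.ne t (hsub ht) i)
    refine ContinuousOn.sub ?_ continuousOn_const
    exact continuous_act.comp_continuousOn (((hb.continuousOn i).mono hsub).prodMk
      ((hq.mono hsub).sub continuousOn_const))
  obtain ⟨z, hz0, hz⟩ := exists_solution_Ici_of_lipschitz hlip hcont z₀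
  refine ⟨z, hz0, fun t ht i m => ?_⟩
  exact hasDerivWithinAt_pi.1 (hasDerivWithinAt_pi.1 (hz t ht) i) m

theorem forwardComplete_errorSolution {M N : ℕ} [NeZero M] (A : Matrix (Fin N) (Fin N) ℝ) (α : ℝ)
    (k : ℕ → ℝ) {t₀ : ℝ} {p : Fin N → ℝ → Space} {x : ℝ → Fin M → Space}
    (hx : ContinuousOn x (Set.Ici t₀)) (hb : IsBearingSensing t₀ p (fun t => x t 0)) :
    ForwardComplete t₀ (ErrorSolution A α k p x) := by
  intro s hs ξ
  obtain ⟨z, hz0, hz⟩ := exists_observerSolution A α k hs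
    (continuousOn_pi.1 hx 0) hb (fun i m => x s m - ξ (m, i))
  refine ⟨fun t => estimationError (x t) (z t), ⟨z, hz, fun _ _ => rfl⟩, ?_⟩
  ext mi : 1
  simp [estimationError, hz0]

/-! ### Right derivatives of the target and of the error -/

/-- At every time the last component of the target state has a right derivative, which obeys every
bound of the input. -/
theorem IsTargetTrajectory.exists_right_deriv {M : ℕ} {t₀ : ℝ} {u : ℝ → Space}
    {x : ℝ → Fin M → Space} (hx : IsTargetTrajectory t₀ u x) (hu : PiecewiseContinuousFrom t₀ u)
    {t T U : ℝ} (ht : t₀ ≤ t) (htT : t < T) (hU : ∀ τ ∈ Set.Icc t T, ‖u τ‖ ≤ U) :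
    ∃ w : Space, ‖w‖ ≤ U ∧ ∀ m : Fin M, (m : ℕ) + 1 = M →
      HasDerivWithinAt (fun τ => x τ m) w (Set.Ici t) t := by
  obtain ⟨l, hl⟩ := hu.2.1 t ht
  have hTn : ∀ᶠ τ in 𝓝[>] t, τ < T := nhdsWithin_le_nhds (Iio_mem_nhds htT)
  refine ⟨l, ?_, fun m hm => ?_⟩
  · refine le_of_tendsto hl.norm ?_
    filter_upwards [hTn, self_mem_nhdsWithin] with τ h1 h2
    exact hU τ ⟨le_of_lt h2, h1.le⟩
  · have hD := hu.1 T
    set D := {t ∈ Set.Icc t₀ T | ¬ ContinuousWithinAt u (Set.Ici t₀) t} with hDdef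
    have hDn : ∀ᶠ τ in 𝓝[>] t, τ ∉ D := by
      -- The discontinuities up to `T` are finite in number, so none lies immediately to the right
      -- of `t`. There the derivative of the last component is `u`, and its right limit at `t` is
      -- the right derivative, even if `u` jumps at `t`.
      have h1 : (D \ {t})ᶜ ∈ 𝓝 t := (hD.subset Set.sdiff_subset).isClosed.isOpen_compl.mem_nhds
        (by simp)
      filter_upwards [nhdsWithin_le_nhds h1, self_mem_nhdsWithin] with τ h2 h3 h4
      exact h2 ⟨h4, ne_of_gt h3⟩
    have hS : {τ | t < τ ∧ τ < T ∧ τ ∉ D} ∈ 𝓝[>] t := by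
      filter_upwards [hTn, hDn, self_mem_nhdsWithin] with τ h1 h2 h3 using ⟨h3, h1, h2⟩
    have hder : ∀ τ ∈ {τ | t < τ ∧ τ < T ∧ τ ∉ D}, HasDerivAt (fun τ => x τ m) (u τ) τ := by
      rintro τ ⟨h1, h2, h3⟩
      have hτ : t₀ < τ := ht.trans_lt h1
      have hc : ContinuousWithinAt u (Set.Ici t₀) τ := by
        by_contra hc
        exact h3 ⟨⟨hτ.le, h2.le⟩, hc⟩
      exact (hx.deriv_last τ hτ.le hc m hm).hasDerivAt (Ici_mem_nhds hτ)
    refine hasDerivWithinAt_Ici_of_tendsto_deriv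
      (fun τ hτ => (hder τ hτ).differentiableAt.differentiableWithinAt) ?_ hS ?_
    · exact (continuousOn_pi.1 hx.continuousOn m t ht).mono fun τ hτ => ht.trans hτ.1.le
    · refine hl.congr' ?_
      filter_upwards [hS] with τ hτ
      exact (hder τ hτ).deriv.symm

/-- Extension of a finite family by zero. -/
def extendZero {M : ℕ} {V : Type*} [Zero V] (v : Fin M → V) (n : ℕ) : V :=
  if h : n < M then v ⟨n, h⟩ else 0

/-- The error components of one agent, divided by the gains and extended by zero. -/
noncomputable def scaledError {M : ℕ} (k : ℕ → ℝ) (v : Fin M → Space) (n : ℕ) : Space :=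
  (k (n + 1))⁻¹ • extendZero v n

theorem extendZero_zero {M : ℕ} [NeZero M] {V : Type*} [Zero V] (v : Fin M → V) :
    extendZero v 0 = v 0 := by
  rw [extendZero, dif_pos (NeZero.pos M)]
  rfl

theorem scaledError_of_le {M : ℕ} (k : ℕ → ℝ) (v : Fin M → Space) {n : ℕ} (h : M ≤ n) :
    scaledError k v n = 0 := by
  simp [scaledError, extendZero, not_lt.2 h]

/-- Beyond the last component both sides are zero, so the unspecified gain `k (M + 1)` inside
`gainRatio k M` is harmless. -/
theorem inv_smul_extendZero_succ {M : ℕ} {k : ℕ → ℝ} (hk : ∀ m, 1 ≤ m → m ≤ M → 0 < k m)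
    (v : Fin M → Space) (n : ℕ) :
    (k (n + 1))⁻¹ • extendZero v (n + 1) = gainRatio k (n + 1) • scaledError k v (n + 1) := by
  by_cases h : n + 1 < M
  · have := hk (n + 1 + 1) (by omega) (by omega)
    rw [scaledError, gainRatio, smul_smul]
    congr 1
    field_simp
  · rw [scaledError_of_le k v (not_lt.1 h), smul_zero]
    simp [extendZero, h]

/-- The correction of agent `i` in terms of the errors `v` of the position estimates. -/
noncomputable def errorCorrection {N : ℕ} (A : Matrix (Fin N) (Fin N) ℝ) (α : ℝ)
    (p : Fin N → Space) (q : Space) (v : Fin N → Space) (i : Fin N) : Space :=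
  act (proj (bearing (p i) q)) (v i) + α • ∑ j, A i j • (v i - v j)

theorem correction_eq_errorCorrection {N : ℕ} (A : Matrix (Fin N) (Fin N) ℝ) (α : ℝ)
    {p : Fin N → Space} {q : Space} (phat : Fin N → Space) (i : Fin N) (h : q ≠ p i) :
    correction A α p q phat i = errorCorrection A α p q (fun j => q - phat j) i := by
  have e : ∑ j, A i j • ((q - phat i) - (q - phat j)) = - ∑ j, A i j • (phat i - phat j) := by
    rw [← Finset.sum_neg_distrib]
    refine Finset.sum_congr rfl fun j _ => ?_
    rw [← smul_neg]
    congr 1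
    abel
  rw [correction_eq A α phat i h, errorCorrection, e, smul_neg, sub_eq_add_neg]

/-- The right derivative of the error components. -/
theorem ErrorSolution.exists_right_deriv {M N : ℕ} [NeZero M] {A : Matrix (Fin N) (Fin N) ℝ}
    {α : ℝ} {k : ℕ → ℝ} {t₀ s : ℝ} {u : ℝ → Space} {p : Fin N → ℝ → Space}
    {x : ℝ → Fin M → Space} (hx : IsTargetTrajectory t₀ u x) (hu : PiecewiseContinuousFrom t₀ u)
    (hb : IsBearingSensing t₀ p (fun t => x t 0)) (hs : t₀ ≤ s) {e : ℝ → ErrorSpace M N}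
    (he : ErrorSolution A α k p x s e) {t T U : ℝ} (ht : s ≤ t) (htT : t < T)
    (hU : ∀ τ ∈ Set.Icc t T, ‖u τ‖ ≤ U) :
    ∃ w : Space, ‖w‖ ≤ U ∧ ∀ i, ∀ n < M,
      HasDerivWithinAt (fun τ => extendZero (fun m => e τ (m, i)) n)
        (extendZero (fun m => e t (m, i)) (n + 1) -
          k (n + 1) • errorCorrection A α (fun j => p j t) (x t 0) (fun j => e t (0, j)) i +
          if n + 1 = M then w else 0) (Set.Ici t) t := by
  obtain ⟨z, hz, hez⟩ := he
  obtain ⟨w, hw, hwd⟩ := hx.exists_right_deriv hu (hs.trans ht) htT hU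
  have hcomp : ∀ τ, s ≤ τ → ∀ m i, e τ (m, i) = x τ m - z τ i m := fun τ hτ m i => by
    rw [hez τ hτ]; rfl
  refine ⟨w, hw, fun i n hn => ?_⟩
  have h1 : HasDerivWithinAt (fun τ => x τ ⟨n, hn⟩)
      (extendZero (x t) (n + 1) + if n + 1 = M then w else 0) (Set.Ici t) t := by
    by_cases hlast : n + 1 = M
    · have := hwd ⟨n, hn⟩ hlast
      simpa [extendZero, hlast] using this
    · have hn1 : n + 1 < M := by omega
      have := (hx.deriv_chain t (hs.trans ht) ⟨n, hn⟩ ⟨n + 1, hn1⟩ rfl).mono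
        (Set.Ici_subset_Ici.2 (hs.trans ht))
      simpa [extendZero, hlast, hn1] using this
  have h2 := (hz t ht i ⟨n, hn⟩).mono (Set.Ici_subset_Ici.2 ht)
  rw [correction_eq_errorCorrection A α _ i (hb.ne t (hs.trans ht) i)] at h2
  have h3 := h1.sub h2
  have e1 : (fun j => x t 0 - z t j 0) = fun j => e t (0, j) := by
    funext j; rw [hcomp t ht]
  rw [e1] at h3
  have e2 : extendZero (fun m => e t (m, i)) (n + 1) = extendZero (x t) (n + 1) -
      if h : n + 1 < M then z t i ⟨n + 1, h⟩ else 0 := by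
    simp only [extendZero]
    split_ifs
    · rw [hcomp t ht]
    · simp
  refine (h3.congr_deriv ?_).congr (fun τ hτ => ?_) ?_
  · rw [e2]; dsimp only; abel
  · simp [extendZero, hn, hcomp τ (ht.trans hτ)]
  · simp [extendZero, hn, hcomp t ht]

theorem ErrorSolution.continuousOn {M N : ℕ} [NeZero M] {A : Matrix (Fin N) (Fin N) ℝ}
    {α : ℝ} {k : ℕ → ℝ} {t₀ s : ℝ} {p : Fin N → ℝ → Space} {x : ℝ → Fin M → Space}
    (hx : ContinuousOn x (Set.Ici t₀)) (hs : t₀ ≤ s) {e : ℝ → ErrorSpace M N}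
    (he : ErrorSolution A α k p x s e) (m : Fin M) (i : Fin N) :
    ContinuousOn (fun τ => e τ (m, i)) (Set.Ici s) := by
  obtain ⟨z, hz, hez⟩ := he
  refine ContinuousOn.congr (f := fun τ => x τ m - z τ i m) ?_ fun τ hτ => by
    rw [hez τ hτ]; rfl
  exact ((continuousOn_pi.1 hx m).mono (Set.Ici_subset_Ici.2 hs)).sub
    fun τ hτ => (hz τ hτ i m).continuousWithinAt

/-! ### The Lyapunov function -/

/-- The sum of the squared increments of the scaled errors of all agents. -/
noncomputable def lyapunov {M N : ℕ} (k : ℕ → ℝ) (e : ErrorSpace M N) : ℝ :=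
  ∑ i, ∑ n ∈ Finset.range M, ‖increment (scaledError k fun m => e (m, i)) n‖ ^ 2

theorem norm_sq_errorSpace {M N : ℕ} (e : ErrorSpace M N) :
    ‖e‖ ^ 2 = ∑ i, ∑ n ∈ Finset.range M, ‖extendZero (fun m => e (m, i)) n‖ ^ 2 := by
  rw [PiLp.norm_sq_eq_of_L2, Fintype.sum_prod_type_right]
  refine Finset.sum_congr rfl fun i _ => ?_
  rw [← Fin.sum_univ_eq_sum_range (fun n => ‖extendZero (fun m => e (m, i)) n‖ ^ 2) M]
  refine Finset.sum_congr rfl fun m _ => ?_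
  simp [extendZero]

/-- Each scaled error is a telescoping sum of at most `M` increments; the factor `M` comes from
Cauchy–Schwarz. -/
theorem norm_sq_le_lyapunov {M N : ℕ} {k : ℕ → ℝ} (hk : ∀ m, 1 ≤ m → m ≤ M → 0 < k m)
    (e : ErrorSpace M N) :
    ‖e‖ ^ 2 ≤ (∑ n ∈ Finset.range M, k (n + 1) ^ 2 * M) * lyapunov k e := by
  rw [norm_sq_errorSpace, lyapunov, Finset.mul_sum]
  refine Finset.sum_le_sum fun i _ => ?_
  rw [Finset.sum_mul]
  refine Finset.sum_le_sum fun n hn => ?_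
  rw [Finset.mem_range] at hn
  set y := scaledError k fun m => e (m, i) with hy
  have hkn := hk (n + 1) (by omega) (by omega)
  have h1 : extendZero (fun m => e (m, i)) n = k (n + 1) • y n := by
    rw [hy, scaledError, smul_smul, mul_inv_cancel₀ hkn.ne', one_smul]
  have h2 : ‖y n‖ ≤ ∑ l ∈ Finset.range M, ‖increment y l‖ := by
    rw [← sum_increment y n]
    exact (norm_sum_le _ _).trans (Finset.sum_le_sum_of_subset_of_nonneg
      (Finset.range_subset_range.2 hn) fun _ _ _ => norm_nonneg _)
  have h3 : ‖y n‖ ^ 2 ≤ M * ∑ l ∈ Finset.range M, ‖increment y l‖ ^ 2 := by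
    have := sq_sum_le_card_mul_sum_sq (s := Finset.range M) (f := fun l => ‖increment y l‖)
    rw [Finset.card_range] at this
    exact (pow_le_pow_left₀ (norm_nonneg _) h2 2).trans this
  rw [h1, norm_smul, mul_pow, Real.norm_eq_abs, sq_abs, mul_assoc]
  gcongr

theorem lyapunov_le_norm_sq {M N : ℕ} (k : ℕ → ℝ) (e : ErrorSpace M N) :
    lyapunov k e ≤
      (∑ _n ∈ Finset.range M, 4 * ∑ l ∈ Finset.range M, ((k (l + 1))⁻¹) ^ 2) * ‖e‖ ^ 2 := by
  rw [norm_sq_errorSpace, lyapunov, Finset.mul_sum]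
  refine Finset.sum_le_sum fun i _ => ?_
  rw [Finset.sum_mul]
  refine Finset.sum_le_sum fun n hn => ?_
  rw [Finset.mem_range] at hn
  set v := fun m => e (m, i)
  set S := ∑ l ∈ Finset.range M, ((k (l + 1))⁻¹) ^ 2
  set R := ∑ l ∈ Finset.range M, ‖extendZero v l‖ ^ 2
  have hS : 0 ≤ S := Finset.sum_nonneg fun _ _ => sq_nonneg _
  have hR : 0 ≤ R := Finset.sum_nonneg fun _ _ => sq_nonneg _
  have h1 : ∀ l < M, ‖scaledError k v l‖ ^ 2 ≤ S * R := by
    intro l hl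
    rw [scaledError, norm_smul, mul_pow, Real.norm_eq_abs, sq_abs]
    exact mul_le_mul
      (Finset.single_le_sum (f := fun l => ((k (l + 1))⁻¹) ^ 2) (fun _ _ => sq_nonneg _)
        (Finset.mem_range.2 hl))
      (Finset.single_le_sum (f := fun l => ‖extendZero v l‖ ^ 2) (fun _ _ => sq_nonneg _)
        (Finset.mem_range.2 hl)) (sq_nonneg _) hS
  have h2 : ‖if n = 0 then (0 : Space) else scaledError k v (n - 1)‖ ^ 2 ≤ S * R := by
    split_ifs
    · simpa using mul_nonneg hS hR
    · exact h1 _ (by omega)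
  have h3 := norm_sub_le (scaledError k v n) (if n = 0 then 0 else scaledError k v (n - 1))
  have h4 := h1 n hn
  rw [increment]
  nlinarith [norm_nonneg (scaledError k v n - if n = 0 then 0 else scaledError k v (n - 1)),
    sq_nonneg (‖scaledError k v n‖ - ‖if n = 0 then (0 : Space) else scaledError k v (n - 1)‖),
    pow_le_pow_left₀ (norm_nonneg _) h3 2]

/-- The derivative of the increments of the scaled error. -/
theorem hasDerivWithinAt_increment {M : ℕ} {k : ℕ → ℝ} (hk : ∀ m, 1 ≤ m → m ≤ M → 0 < k m)
    {v : ℝ → Fin M → Space} {d w : Space} {S : Set ℝ} {t : ℝ}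
    (hv : ∀ n < M, HasDerivWithinAt (fun τ => extendZero (v τ) n)
      (extendZero (v t) (n + 1) - k (n + 1) • d + if n + 1 = M then w else 0) S t)
    {n : ℕ} (hn : n < M) :
    HasDerivWithinAt (fun τ => increment (scaledError k (v τ)) n)
      (chainDrift k (scaledError k (v t)) n - (if n = 0 then d else 0) +
        if n + 1 = M then (k M)⁻¹ • w else 0) S t := by
  have hy : ∀ n < M, HasDerivWithinAt (fun τ => scaledError k (v τ) n)
      (gainRatio k (n + 1) • scaledError k (v t) (n + 1) - d +
        if n + 1 = M then (k M)⁻¹ • w else 0) S t := by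
    intro n hn
    refine ((hv n hn).const_smul (k (n + 1))⁻¹).congr_deriv ?_
    have hkn := hk (n + 1) (by omega) (by omega)
    rw [smul_add, smul_sub, inv_smul_extendZero_succ hk, smul_smul, inv_mul_cancel₀ hkn.ne',
      one_smul]
    split_ifs with h
    · rw [h]
    · rw [smul_zero]
  rcases n with _ | n
  · simpa [increment, chainDrift] using hy 0 hn
  · have h := (hy (n + 1) hn).sub (hy n (by omega))
    simp only [increment, chainDrift, Nat.succ_ne_zero, if_false, Nat.add_sub_cancel]
    refine h.congr_deriv ?_
    rw [if_neg (by omega : ¬ n + 1 = M)]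
    abel

/-- The dissipation inequality for the errors of all agents. -/
theorem lyapunov_dissipation {M N : ℕ} [NeZero M] {k : ℕ → ℝ}
    (hk : ∀ m, 1 ≤ m → m ≤ M → 0 < k m) {μ q : ℝ} (hq : 0 < q)
    (hdiss : ∀ y : ℕ → Space, (∀ n, M ≤ n → y n = 0) →
      ∑ n ∈ Finset.range M, inner ℝ (increment y n) (chainDrift k y n) - k 1 * μ * ‖y 0‖ ^ 2 ≤
        - q * ∑ n ∈ Finset.range M, ‖increment y n‖ ^ 2)
    (e : ErrorSpace M N) (d : Fin N → Space) (w : Space)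
    (hd : μ * ∑ i, ‖e (0, i)‖ ^ 2 ≤ ∑ i, inner ℝ (e (0, i)) (d i)) :
    ∑ i, ∑ n ∈ Finset.range M, 2 * inner ℝ (increment (scaledError k fun m => e (m, i)) n)
      (chainDrift k (scaledError k fun m => e (m, i)) n - (if n = 0 then d i else 0) +
        if n + 1 = M then (k M)⁻¹ • w else 0) ≤
      - q * lyapunov k e + N * ((k M)⁻¹ * ‖w‖) ^ 2 / q := by
  have hM : 1 ≤ M := NeZero.one_le
  have hk1 := hk 1 le_rfl hM
  have hkM := hk M hM le_rfl
  set W := (k M)⁻¹ • w with hW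
  have hWn : ‖W‖ = (k M)⁻¹ * ‖w‖ := by
    rw [hW, norm_smul, Real.norm_of_nonneg (inv_nonneg.2 hkM.le)]
  have hagent : ∀ i, ∑ n ∈ Finset.range M,
      2 * inner ℝ (increment (scaledError k fun m => e (m, i)) n)
      (chainDrift k (scaledError k fun m => e (m, i)) n - (if n = 0 then d i else 0) +
        if n + 1 = M then W else 0) ≤
      2 * ((k 1)⁻¹ * μ * ‖e (0, i)‖ ^ 2 - (k 1)⁻¹ * inner ℝ (e (0, i)) (d i)) -
        q * ∑ n ∈ Finset.range M, ‖increment (scaledError k fun m => e (m, i)) n‖ ^ 2 +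
        ‖W‖ ^ 2 / q := by
    intro i
    set y := scaledError k fun m => e (m, i) with hy
    have hy0 : y 0 = (k 1)⁻¹ • e (0, i) := by rw [hy, scaledError, extendZero_zero]
    have hinc0 : increment y 0 = y 0 := by simp [increment]
    have h1 := hdiss y fun n hn => scaledError_of_le k _ hn
    have h2 : ∑ n ∈ Finset.range M, inner ℝ (increment y n) (if n = 0 then d i else 0) =
        (k 1)⁻¹ * inner ℝ (e (0, i)) (d i) := by
      rw [Finset.sum_eq_single_of_mem 0 (Finset.mem_range.2 hM)
        (fun n _ hn => by rw [if_neg hn, inner_zero_right]), if_pos rfl, hinc0, hy0,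
        real_inner_smul_left]
    have hmem : M - 1 ∈ Finset.range M := Finset.mem_range.2 (by omega)
    have h3 : ∑ n ∈ Finset.range M, inner ℝ (increment y n) (if n + 1 = M then W else 0) =
        inner ℝ (increment y (M - 1)) W := by
      rw [Finset.sum_eq_single_of_mem (M - 1) hmem
        (fun n _ hn => by rw [if_neg (by omega), inner_zero_right]), if_pos (by omega)]
    have h4 : ‖increment y (M - 1)‖ ^ 2 ≤ ∑ n ∈ Finset.range M, ‖increment y n‖ ^ 2 :=
      Finset.single_le_sum (f := fun n => ‖increment y n‖ ^ 2) (fun _ _ => sq_nonneg _) hmem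
    -- Young's inequality with weight `q`: of the dissipation `2 * q` in the doubled inequality, one
    -- `q` absorbs the input and the other remains as decay rate.
    have h5 : 2 * inner ℝ (increment y (M - 1)) W ≤
        q * ‖increment y (M - 1)‖ ^ 2 + ‖W‖ ^ 2 / q := by
      have h6 := real_inner_le_norm (increment y (M - 1)) W
      have h7 : q * ‖increment y (M - 1)‖ ^ 2 + ‖W‖ ^ 2 / q -
          2 * (‖increment y (M - 1)‖ * ‖W‖) = (q * ‖increment y (M - 1)‖ - ‖W‖) ^ 2 / q := by
        field_simp
        ring
      have h8 : 0 ≤ (q * ‖increment y (M - 1)‖ - ‖W‖) ^ 2 / q := by positivity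
      linarith
    have h6 : k 1 * μ * ‖y 0‖ ^ 2 = (k 1)⁻¹ * μ * ‖e (0, i)‖ ^ 2 := by
      rw [hy0, norm_smul, Real.norm_of_nonneg (inv_nonneg.2 hk1.le)]
      field_simp
    have h7 := mul_le_mul_of_nonneg_left h4 hq.le
    simp only [inner_add_right, inner_sub_right, ← Finset.mul_sum, Finset.sum_add_distrib,
      Finset.sum_sub_distrib, h2, h3]
    linarith
  refine (Finset.sum_le_sum fun i _ => hagent i).trans ?_
  rw [Finset.sum_add_distrib, Finset.sum_sub_distrib, ← Finset.mul_sum, ← Finset.mul_sum,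
    Finset.sum_sub_distrib, ← Finset.mul_sum, ← Finset.mul_sum, ← hWn]
  simp only [Finset.sum_const, Finset.card_univ, Fintype.card_fin, nsmul_eq_mul]
  have h1 := mul_le_mul_of_nonneg_left hd (inv_nonneg.2 hk1.le)
  rw [lyapunov, mul_div_assoc]
  linarith

/-- Decay of the Lyapunov function along the errors. -/
theorem lyapunov_le_of_deriv {M N : ℕ} [NeZero M] {k : ℕ → ℝ}
    (hk : ∀ m, 1 ≤ m → m ≤ M → 0 < k m) {μ q : ℝ} (hq : 0 < q)
    (hdiss : ∀ y : ℕ → Space, (∀ n, M ≤ n → y n = 0) →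
      ∑ n ∈ Finset.range M, inner ℝ (increment y n) (chainDrift k y n) - k 1 * μ * ‖y 0‖ ^ 2 ≤
        - q * ∑ n ∈ Finset.range M, ‖increment y n‖ ^ 2)
    {s T U : ℝ} (hsT : s ≤ T) {e : ℝ → ErrorSpace M N}
    (hcont : ∀ m i, ContinuousOn (fun τ => e τ (m, i)) (Set.Icc s T))
    (hderiv : ∀ t ∈ Set.Ico s T, ∃ (d : Fin N → Space) (w : Space), ‖w‖ ≤ U ∧
      μ * ∑ i, ‖e t (0, i)‖ ^ 2 ≤ ∑ i, inner ℝ (e t (0, i)) (d i) ∧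
      ∀ i, ∀ n < M, HasDerivWithinAt (fun τ => extendZero (fun m => e τ (m, i)) n)
        (extendZero (fun m => e t (m, i)) (n + 1) - k (n + 1) • d i +
          if n + 1 = M then w else 0) (Set.Ici t) t) :
    lyapunov k (e T) ≤ lyapunov k (e s) * Real.exp (- q * (T - s)) +
      N * ((k M)⁻¹ * U) ^ 2 / q / q := by
  have hM : 1 ≤ M := NeZero.one_le
  have hkM := hk M hM le_rfl
  have hVcont : ContinuousOn (fun τ => lyapunov k (e τ)) (Set.Icc s T) := by
    have hext : ∀ i n, ContinuousOn (fun τ => scaledError k (fun m => e τ (m, i)) n)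
        (Set.Icc s T) := by
      intro i n
      refine ContinuousOn.fun_const_smul ?_ _
      by_cases h : n < M
      · simpa [extendZero, h] using hcont ⟨n, h⟩ i
      · simpa [extendZero, h] using continuousOn_const
    refine continuousOn_finsetSum _ fun i _ => continuousOn_finsetSum _ fun n _ =>
      ((ContinuousOn.sub (hext i n) ?_).norm.pow 2)
    split_ifs
    · exact continuousOn_const
    · exact hext i _
  have hV : ∀ t ∈ Set.Ico s T, ∃ V' : ℝ,
      HasDerivWithinAt (fun τ => lyapunov k (e τ)) V' (Set.Ici t) t ∧
      V' ≤ - q * lyapunov k (e t) + N * ((k M)⁻¹ * U) ^ 2 / q := by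
    intro t ht
    obtain ⟨d, w, hw, hd, h⟩ := hderiv t ht
    refine ⟨_, HasDerivWithinAt.fun_sum fun i _ => HasDerivWithinAt.fun_sum fun n hn =>
      (hasDerivWithinAt_increment hk (h i) (Finset.mem_range.1 hn)).norm_sq, ?_⟩
    refine (lyapunov_dissipation hk hq hdiss (e t) d w hd).trans ?_
    gcongr
  choose! V' hV' hVb using hV
  -- This form of Grönwall's inequality needs only right derivatives, so jumps of the input cause no
  -- difficulty; the negative constant `-q` yields decay.
  have hgr := le_gronwallBound_of_liminf_deriv_right_le hVcont
    (f' := V') (δ := lyapunov k (e s)) (K := -q) (ε := N * ((k M)⁻¹ * U) ^ 2 / q)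
    (fun t ht r hr => (hV' t ht).liminf_right_slope_le hr) le_rfl hVb T ⟨hsT, le_rfl⟩
  rw [gronwallBound_of_K_ne_0 (neg_ne_zero.2 hq.ne')] at hgr
  refine hgr.trans ?_
  dsimp only
  have hε : 0 ≤ N * ((k M)⁻¹ * U) ^ 2 / q / q := by positivity
  have : N * ((k M)⁻¹ * U) ^ 2 / q / -q * (Real.exp (-q * (T - s)) - 1) =
      N * ((k M)⁻¹ * U) ^ 2 / q / q - N * ((k M)⁻¹ * U) ^ 2 / q / q * Real.exp (-q * (T - s)) := by
    rw [div_neg]; ring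
  rw [this]
  have := mul_nonneg hε (Real.exp_pos (-q * (T - s))).le
  linarith

/-- The linear estimate behind exponential and input-to-state stability. -/
theorem exists_error_estimate {M N : ℕ} [NeZero M] (hN : 2 ≤ N)
    {G : SimpleGraph (Fin N)} (hG : G.Connected)
    {A : Matrix (Fin N) (Fin N) ℝ} (hA : IsWeightedAdjacency G A)
    {k : ℕ → ℝ} (hk : ∀ m, 1 ≤ m → m ≤ M → 0 < k m)
    {α δ γ : ℝ} (hα : 0 < α) (hδ : 0 < δ) (hγ : 0 < γ)
    (hαγ : α > (muConst M k δ + 1 / γ - 1) / minPosEigenvalue (laplacian A))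
    (hQ : 3 ≤ M → (qBar M k δ).PosDef) :
    ∃ C r D : ℝ, 0 < C ∧ 0 < r ∧ 0 < D ∧
      ∀ (t₀ : ℝ) (u : ℝ → Space) (p : Fin N → ℝ → Space) (x : ℝ → Fin M → Space),
        PiecewiseContinuousFrom t₀ u →
        IsTargetTrajectory t₀ u x →
        IsBearingSensing t₀ p (fun t => x t 0) →
        SpatialExcitation (muConst M k δ + γ) t₀ p (fun t => x t 0) →
        ∀ s, t₀ ≤ s → ∀ e, ErrorSolution A α k p x s e → ∀ T, s ≤ T →
        ∀ U, 0 ≤ U → (∀ τ ∈ Set.Icc s T, ‖u τ‖ ≤ U) →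
          ‖e T‖ ≤ C * Real.exp (-r * (T - s)) * ‖e s‖ + D * U := by
  obtain ⟨q, hq, hdiss⟩ := exists_dissipation hk hδ hQ
  have hM : 1 ≤ M := NeZero.one_le
  have hkM := hk M hM le_rfl
  set c₁ : ℝ := ∑ n ∈ Finset.range M, k (n + 1) ^ 2 * M with hc₁
  set c₂ : ℝ := ∑ _n ∈ Finset.range M, 4 * ∑ l ∈ Finset.range M, ((k (l + 1))⁻¹) ^ 2 with hc₂
  have hrange : (Finset.range M).Nonempty := ⟨0, Finset.mem_range.2 hM⟩
  have hMpos : (0 : ℝ) < M := by exact_mod_cast hM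
  have hc₁pos : 0 < c₁ := Finset.sum_pos (fun n hn => by
    have := hk (n + 1) (by omega) (by have := Finset.mem_range.1 hn; omega)
    positivity) hrange
  have hc₂pos : 0 < c₂ := Finset.sum_pos (fun _ _ => mul_pos four_pos
    (Finset.sum_pos (fun n hn => by
      have := hk (n + 1) (by omega) (by have := Finset.mem_range.1 hn; omega)
      positivity) hrange)) hrange
  have hNpos : (0 : ℝ) < N := by exact_mod_cast (by omega : 0 < N)
  have hN0 : (0 : ℝ) ≤ N := hNpos.le
  refine ⟨√(c₁ * c₂), q / 2, √(c₁ * N) * ((k M)⁻¹ / q), by positivity, by positivity,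
    by positivity, ?_⟩
  intro t₀ u p x hu hx hb hexc s hs e he T hT U hU0 hU
  have hV := lyapunov_le_of_deriv hk hq hdiss (U := U) hT
    (fun m i => (ErrorSolution.continuousOn hx.continuousOn hs he m i).mono
      Set.Icc_subset_Ici_self) (fun t ht => by
      obtain ⟨w, hw, hd⟩ := ErrorSolution.exists_right_deriv hx hu hb hs he ht.1 ht.2
        fun τ hτ => hU τ ⟨ht.1.trans hτ.1, hτ.2⟩
      refine ⟨fun i => errorCorrection A α (fun j => p j t) (x t 0) (fun j => e t (0, j)) i, w, hw,
        ?_, hd⟩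
      exact correction_coercive hN hG hA (muConst_pos hk hδ) hγ hα hαγ
        (fun i => norm_bearing (hb.ne t (hs.trans ht.1) i)) (hexc t (hs.trans ht.1))
        fun j => e t (0, j))
  have h1 := norm_sq_le_lyapunov hk (e T)
  have h2 := lyapunov_le_norm_sq k (e s)
  rw [← hc₁] at h1
  rw [← hc₂] at h2
  set x₁ := √(c₁ * c₂) * Real.exp (-(q / 2) * (T - s)) * ‖e s‖ with hx₁
  set x₂ := √(c₁ * N) * ((k M)⁻¹ / q) * U with hx₂
  have hx₁0 : 0 ≤ x₁ := by positivity
  have hx₂0 : 0 ≤ x₂ := by positivity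
  have hs1 : x₁ ^ 2 = c₁ * (c₂ * ‖e s‖ ^ 2 * Real.exp (-q * (T - s))) := by
    have : Real.exp (-q * (T - s)) = Real.exp (-(q / 2) * (T - s)) ^ 2 := by
      rw [sq, ← Real.exp_add]; congr 1; ring
    rw [hx₁, mul_pow, mul_pow, Real.sq_sqrt (by positivity), this]; ring
  have hs2 : x₂ ^ 2 = c₁ * (N * ((k M)⁻¹ * U) ^ 2 / q / q) := by
    rw [hx₂, mul_pow, mul_pow, Real.sq_sqrt (by positivity)]
    field_simp
  -- The constants are chosen so that `x₁ ^ 2` and `x₂ ^ 2` are the two terms of the Grönwall bound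
  -- times `c₁`. As both are nonnegative, the sum of squares is at most `(x₁ + x₂) ^ 2`; taking
  -- roots halves the rate `q`.
  have h3 : ‖e T‖ ^ 2 ≤ x₁ ^ 2 + x₂ ^ 2 := by
    rw [hs1, hs2, ← mul_add]
    refine h1.trans (mul_le_mul_of_nonneg_left (hV.trans ?_) hc₁pos.le)
    gcongr
  exact abs_le_of_sq_le_sq' (by nlinarith [mul_nonneg hx₁0 hx₂0]) (by positivity) |>.2

/-! ### Comparison functions -/

theorem isClassK_mul_left {D : ℝ} (hD : 0 < D) : IsClassK fun r => D * r :=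
  ⟨by fun_prop, fun _ _ _ _ h => mul_lt_mul_of_pos_left h hD, mul_zero D⟩

theorem isClassKL_exp {C r : ℝ} (hC : 0 < C) (hr : 0 < r) :
    IsClassKL fun a t => C * Real.exp (-r * t) * a where
  continuousOn := by fun_prop
  classK t _ := isClassK_mul_left (by positivity)
  antitoneOn a ha t _ t' _ h := by
    have : -r * t' ≤ -r * t := by nlinarith
    dsimp only
    gcongr
  tendsto_zero a _ := by
    have h1 : Filter.Tendsto (fun t : ℝ => -r * t) Filter.atTop Filter.atBot :=
      Filter.tendsto_id.const_mul_atTop_of_neg (neg_lt_zero.2 hr)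
    have h2 := ((Real.tendsto_exp_atBot.comp h1).const_mul C).mul_const a
    simpa using h2

theorem piecewiseContinuousFrom_zero (t₀ : ℝ) :
    PiecewiseContinuousFrom t₀ (fun _ => (0 : Space)) := by
  refine ⟨fun T => ?_, fun t _ => ⟨0, tendsto_const_nhds⟩, fun t _ => ⟨0, tendsto_const_nhds⟩⟩
  simp [continuousWithinAt_const]

end BearingObserver

/-! ### Exponential and input-to-state stability from the affine estimate -/

open BearingObserver in
theorem mainTheorem5 {M N : ℕ} [NeZero M] (hN : 2 ≤ N)
    (G : SimpleGraph (Fin N)) (hG : G.Connected)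
    (A : Matrix (Fin N) (Fin N) ℝ) (hA : IsWeightedAdjacency G A)
    (k : ℕ → ℝ) (hk : ∀ m, 1 ≤ m → m ≤ M → 0 < k m)
    (α δ γ : ℝ) (hα : 0 < α) (hδ : 0 < δ) (hγ : 0 < γ)
    (hαγ : α > (muConst M k δ + 1 / γ - 1) / minPosEigenvalue (laplacian A))
    (hQ : 3 ≤ M → (qBar M k δ).PosDef) :
    -- the two expressions of the measurement agree
    (∀ p q : Space, q ≠ p → act (proj (bearing p q)) p = act (proj (bearing p q)) q) ∧
    -- UGES of the estimation error for the autonomous target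
    (∃ C r : ℝ, 0 < C ∧ 0 < r ∧
      ∀ (t₀ : ℝ) (p : Fin N → ℝ → Space) (x : ℝ → Fin M → Space),
        IsTargetTrajectory t₀ (fun _ => 0) x →
        IsBearingSensing t₀ p (fun t => x t 0) →
        SpatialExcitation (muConst M k δ + γ) t₀ p (fun t => x t 0) →
        UGESWith C r t₀ (ErrorSolution A α k p x)) ∧
    -- ISS of the estimation error with respect to the input of the target
    (∃ (β : ℝ → ℝ → ℝ) (ρ : ℝ → ℝ), IsClassKL β ∧ IsClassK ρ ∧
      ∀ (t₀ : ℝ) (u : ℝ → Space) (p : Fin N → ℝ → Space) (x : ℝ → Fin M → Space),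
        BoundedFrom t₀ u → PiecewiseContinuousFrom t₀ u →
        IsTargetTrajectory t₀ u x →
        IsBearingSensing t₀ p (fun t => x t 0) →
        SpatialExcitation (muConst M k δ + γ) t₀ p (fun t => x t 0) →
        ISSWith β ρ t₀ u (ErrorSolution A α k p x)) := by
  obtain ⟨C, r, D, hC, hr, hD, hest⟩ :=
    exists_error_estimate hN hG hA hk hα hδ hγ hαγ hQ
  refine ⟨fun p q h => act_proj_bearing_eq h, ⟨C, r, hC, hr, ?_⟩,
    ⟨fun a t => C * Real.exp (-r * t) * a, fun a => D * a, isClassKL_exp hC hr,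
      isClassK_mul_left hD, ?_⟩⟩
  · intro t₀ p x hx hb hexc
    refine ⟨forwardComplete_errorSolution A α k hx.continuousOn hb, fun s hs e he T hT => ?_⟩
    have := hest t₀ _ p x (piecewiseContinuousFrom_zero t₀) hx hb hexc s hs e he T hT 0 le_rfl
      (by simp)
    simpa using this
  · intro t₀ u p x ⟨B, hB⟩ hu hx hb hexc
    refine ⟨forwardComplete_errorSolution A α k hx.continuousOn hb, fun s hs e he T hT => ?_⟩
    -- Boundedness of `u` makes the real supremum a genuine upper bound rather than the default
    -- value `0`.
    have hbdd : BddAbove ((fun τ => ‖u τ‖) '' Set.Icc s T) := by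
      refine ⟨B, ?_⟩
      rintro _ ⟨τ, hτ, rfl⟩
      exact hB τ (hs.trans hτ.1)
    have hU : ∀ τ ∈ Set.Icc s T, ‖u τ‖ ≤ sSup ((fun τ => ‖u τ‖) '' Set.Icc s T) :=
      fun τ hτ => le_csSup hbdd ⟨τ, hτ, rfl⟩
    exact hest t₀ u p x hu hx hb hexc s hs e he T hT _
      ((norm_nonneg _).trans (hU s ⟨le_rfl, hT⟩)) hU
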